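/- Let $\beta\in(1,2)$ be a hyperbolic algebraic integer: $\beta$ is a root of a non-zero polynomial with coefficients in $\{-1,0,1\}$ and no Galois conjugate of $\beta$ has modulus $1$. Let $X(\beta)=\{\sum_{i=1}^n c_i\beta^{n-i}: n\in\mathbb N,\ c_i\in\{-1,0,1\}\}$ and, for $x\in\mathbb R$, let $\mathcal N_n(x)$ be the number of pairs $(a,b)\in\{0,1\}^n\times\{0,1\}^n$ with $\sum_{i=1}^n(a_i-b_i)\beta^{n-i}=x$. Let $\beta=\beta_1,\beta_2,\dots$ be the Galois conjugates of $\beta$, one taken from each pair of complex conjugates, let $\mathbb F_j=\mathbb R$ if $\beta_j\in\mathbb R$ and $\mathbb F_j=\mathbb C$ otherwise, $\mathbb K=\prod_j\mathbb F_j$, $\mathbb K_c=\prod_{|\beta_j|<1}\mathbb F_j$, and let $\pi_c:\mathbb K\to\mathbb K_c$ be the projection. Put $\bar\beta^m=(\beta_j^m)_j\in\mathbb K$, $\bar Z=\{\sum_{m<\deg\beta}z_m\bar\beta^m: z_m\in\mathbb Z\}$, $\bar X(\beta)=\{\sum_{i=1}^n c_i\bar\beta^{n-i}: n\in\mathbb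 N,\ c_i\in\{-1,0,1\}\}$ and $B=\{x\in\mathbb K: |x_j|<1/\bigl||\beta_j|-1\bigr| \text{ for all } j\}$. For $i\in\{-1,0,1\}$ let $S_i(x)=(\beta_jx_j+i)_j$ on $\mathbb K_c$ and let $\mathcal R\subset\mathbb K_c$ be the attractor of $\{S_{-1},S_0,S_1\}$. To $x=\sum_{i=1}^n c_i\beta^{n-i}\in X(\beta)$ corresponds the point $x_c=\bigl(\sum_{i=1}^n c_i\beta_j^{n-i}\bigr)_{|\beta_j|<1}\in\mathcal R$, which does not depend on the code $c_1\cdots c_n$ of $x$. For a word $a=a_1\cdots a_n$ over $\{-1,0,1\}$ put $[a]=S_{a_1}\circ\cdots\circ S_{a_n}(\mathcal R)$. Let $T_i(t)=\beta t+i$, and let $\Delta$ be the set of all differences $x-y$ with $x,y\in X(\beta)$ such that $T_{c_n}\circ\cdots\circ T_{c_1}(x)=T_{d_n}\circ\cdots\circ T_{d_1}(y)$ for some $n$ and some $c,d\in\{-1,0,1\}^n$. For an enumeration $\Delta=\{v_0,\dots,v_k\}$ with $v_0=0$ and $i\in\{-1,0,1\}$ let $A_i$ be the $(k+1)\times(k+1)$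 matrix whose $(m,n)$ entry is $2$ if $T_{-i}(v_m)=v_n$, is $1$ if $T_{1-i}(v_m)=v_n$ or $T_{-1-i}(v_m)=v_n$, and is $0$ otherwise; for a word $w=w_1\cdots w_l$ put $A_w=A_{w_1}\cdots A_{w_l}$. For non-negative row vectors $U,V$ let $d(U,V)=\max_{i,j}\bigl|\ln\frac{U_i}{V_i}-\ln\frac{U_j}{V_j}\bigr|$ over the indices of the non-zero entries if $U$ and $V$ have the same zero entries, and $d(U,V)=\infty$ otherwise. Assume that $\bar X(\beta)\cap\overline{B}=\bar Z\cap\pi_c^{-1}(\mathcal R^{\mathrm o})\cap\overline{B}$ (Condition 1), where $\mathcal R^{\mathrm o}$ is the interior of $\mathcal R$. Then there is $\lambda>1$ such that $\mu(x)=\lim_{n\to\infty}\lambda^{-n}\mathcal N_n(x)$ exists for every $x\in\mathbb R$ and is positive for $x\in X(\beta)$. The set $\Delta$ is finite, $\Delta=\{v_0=0,v_1,\dots,v_k\}$, every $x\in X(\beta)$ is reached from $0$ by finitely many translations from $\Delta$, without leaving $X(\beta)$, and there are functions $f_0,\dots,f_k:\mathcal R\to\mathbb R$, a word $w$ over $\{-1,0,1\}$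 and constants $C_1>0$, $C_2\in(0,1)$ such that the following hold. 1. $\ln\bigl(\mu(x+v_j)/\mu(x)\bigr)=f_j(x_c)$ for all $j$ and all $x\in X(\beta)$ with $x+v_j\in X(\beta)$. 2. $w$ is mixing: there are sets of indices $I,J$, neither containing $0$, such that $(A_w)_{i,j}=0$ if and only if $i\in I$ or $j\in J$. 3. For all non-negative row vectors $U,V$ with $U_0,V_0>0$: $d(UA_w,VA_w)\le C_1$; and if $d(U,V)<\infty$, then $d(UA_w,VA_w)\le C_2\,d(U,V)$ and $d(UA_i,VA_i)\le d(U,V)$ for $i\in\{-1,0,1\}$. 4. For every $r\ge1$ and every word $a$ over $\{-1,0,1\}$ that contains $r$ disjoint copies of $w$: if $x,y\in X(\beta)$ and $x_c,y_c\in[a]$, then $d\bigl((\mu(x+v_j))_j,(\mu(y+v_j))_j\bigr)\le C_1C_2^{r-1}$; and $|f_j(p)-f_j(q)|\le C_1C_2^{r-1}$ for all $j$ and all $p,q\in[a]$. -/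

import Mathlib

open Filter Topology

noncomputable section

namespace Spectra

/-! ### Digits, words, and orbits of the maps `t ↦ b t + i` -/

/-- The alphabet `{-1, 0, 1}`. -/
def IsDigit (i : ℤ) : Prop := i = -1 ∨ i = 0 ∨ i = 1

/-- Finite words over `{-1, 0, 1}`. -/
def IsWord (a : List ℤ) : Prop := ∀ i ∈ a, IsDigit i

/-- The expanding/contracting maps `t ↦ b t + i`; used in `ℝ`, in the full space `K`
and in the contracting space. -/
def T {A : Type*} [Ring A] (b : A) (i : ℤ) (t : A) : A := b * t + (i : A)

/-- `orbit b [c₁, …, cₙ] t = T_{cₙ} ∘ ⋯ ∘ T_{c₁} (t)`. -/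
def orbit {A : Type*} [Ring A] (b : A) (c : List ℤ) (t : A) : A :=
  c.foldl (fun s i => T b i s) t

/-- The value `∑_{i=1}^n c_i b^{n-i}` of a word `c₁ ⋯ cₙ`. -/
def value {A : Type*} [Ring A] (b : A) (c : List ℤ) : A :=
  ∑ i : Fin c.length, ((c.get i : ℤ) : A) * b ^ (c.length - 1 - (i : ℕ))

/-- `w` occurs (at least) `r` times in `a`, at pairwise disjoint positions. -/
def HasDisjointCopies (w : List ℤ) : ℕ → List ℤ → Prop
  | 0, _ => True
  | r + 1, a => ∃ p q : List ℤ, a = p ++ w ++ q ∧ HasDisjointCopies w r q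

/-! ### The number `β` and its spectrum -/

/-- Hyperbolic numbers: algebraic integers `β ∈ (1, 2)` that are roots of a nonzero polynomial with
coefficients in `{-1, 0, 1}` and have no Galois conjugate of modulus one. -/
structure IsHyperbolic (β : ℝ) : Prop where
  one_lt : 1 < β
  lt_two : β < 2
  isIntegral : IsIntegral ℤ β
  exists_poly : ∃ p : Polynomial ℤ, p ≠ 0 ∧ (∀ n, IsDigit (p.coeff n)) ∧ Polynomial.aeval β p = 0
  norm_ne_one : ∀ z ∈ (minpoly ℚ β).rootSet ℂ, ‖z‖ ≠ 1

/-- The spectrum `X(β) ⊆ ℝ`. -/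
def spectrum (β : ℝ) : Set ℝ := {x | ∃ c : List ℤ, IsWord c ∧ x = value β c}

/-- `𝒩ₙ(x)`: the number of pairs of words `a, b ∈ {0,1}ⁿ` with `∑ (a_i - b_i) β^{n-i} = x`. -/
def count (β : ℝ) (n : ℕ) (x : ℝ) : ℕ :=
  Nat.card {p : (Fin n → Fin 2) × (Fin n → Fin 2) //
    ∑ i : Fin n, (((p.1 i : ℕ) : ℝ) - ((p.2 i : ℕ) : ℝ)) * β ^ (n - 1 - (i : ℕ)) = x}

/-- The translations `Δ`: differences of two points of the spectrum which can be mapped to the same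
point by words of the same length. -/
def translations (β : ℝ) : Set ℝ :=
  {t | ∃ x ∈ spectrum β, ∃ y ∈ spectrum β, t = x - y ∧
    ∃ c d : List ℤ, IsWord c ∧ IsWord d ∧ c.length = d.length ∧ orbit β c x = orbit β d y}

/-! ### The space `K`, the contracting space and the attractor -/

/-- `𝔽_z`: it is `ℝ` if `z` is real and `ℂ` otherwise, as a subalgebra of `ℂ`. -/
def coordField (z : ℂ) : Subalgebra ℝ ℂ where
  carrier := {w | z.im = 0 → w.im = 0}
  mul_mem' := by
    intro a b ha hb hz
    simp [Complex.mul_im, ha hz, hb hz]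
  add_mem' := by
    intro a b ha hb hz
    simp [ha hz, hb hz]
  algebraMap_mem' := by
    intro r _
    simp

/-- The Galois conjugates of `β` (including `β`), one from each pair of complex conjugates. -/
abbrev Place (β : ℝ) : Type := {z : ℂ // z ∈ (minpoly ℚ β).rootSet ℂ ∧ 0 ≤ z.im}

/-- Those of modulus less than one. -/
abbrev CPlace (β : ℝ) : Type := {z : Place β // ‖(z : ℂ)‖ < 1}

/-- The space `K = ∏ 𝔽_{β_i}`. -/
abbrev FullSpace (β : ℝ) : Type := (z : Place β) → coordField (z : ℂ)

/-- The contracting space `K_c`. -/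
abbrev ContractingSpace (β : ℝ) : Type := (z : CPlace β) → coordField (z.1 : ℂ)

/-- The projection `π_c : K → K_c`. -/
def projC (β : ℝ) (x : FullSpace β) : ContractingSpace β := fun z => x z.1

/-- The element `(β_i)_i` of `K`. -/
def conj (β : ℝ) : FullSpace β := fun z => ⟨(z : ℂ), fun h => h⟩

/-- The element `(β_i)_i` of `K_c`. -/
def conjC (β : ℝ) : ContractingSpace β := projC β (conj β)

/-- The lattice `Z̄` of integer combinations of `(β_i^m)_i`, `m < deg β`. -/
def lattice (β : ℝ) : Set (FullSpace β) :=
  {x | ∃ a : Fin (minpoly ℚ β).natDegree → ℤ, x = ∑ m, (a m : FullSpace β) * conj β ^ (m : ℕ)}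

/-- The lifted spectrum `X̄(β) ⊆ K`. -/
def liftedSpectrum (β : ℝ) : Set (FullSpace β) :=
  {x | ∃ c : List ℤ, IsWord c ∧ x = value (conj β) c}

/-- The box `B_β(R)`. -/
def box (β R : ℝ) : Set (FullSpace β) :=
  {x | ∀ z : Place β, ‖(x z : ℂ)‖ < R / |‖(z : ℂ)‖ - 1|}

/-- The attractor `𝓡` of the contractions `S_i(x) = (β_j x_j + i)_j`, `i ∈ {-1, 0, 1}`, of `K_c`:
the set of all `∑_k a_k (β_j^k)_j` with `a_k ∈ {-1, 0, 1}`. -/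
def attractor (β : ℝ) : Set (ContractingSpace β) :=
  {x | ∃ a : ℕ → ℤ, (∀ k, IsDigit (a k)) ∧
    ∀ z : CPlace β, HasSum (fun k => ((a k : ℤ) : ℂ) * (z.1 : ℂ) ^ k) (x z : ℂ)}

/-- The cylinder `[a₁, …, aₙ] = S_{a₁} ∘ ⋯ ∘ S_{aₙ} (𝓡)`. -/
def cylinder (β : ℝ) (a : List ℤ) : Set (ContractingSpace β) :=
  a.foldr (fun i E => T (conjC β) i '' E) (attractor β)

/-- The finite cut-and-project check near the origin:
`X̄(β) ∩ cl B_β(1) = Z̄ ∩ π_c⁻¹(int 𝓡) ∩ cl B_β(1)`. -/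
def CutProjectCondition (β : ℝ) : Prop :=
  liftedSpectrum β ∩ closure (box β 1) =
    lattice β ∩ projC β ⁻¹' interior (attractor β) ∩ closure (box β 1)

/-! ### Transition matrices -/

open Classical in
/-- The matrix `A_i`, for an enumeration `v` of `Δ`. -/
def transition (β : ℝ) {k : ℕ} (v : Fin k → ℝ) (i : ℤ) : Matrix (Fin k) (Fin k) ℝ :=
  fun m n =>
    if T β (-i) (v m) = v n then 2
    else if T β (1 - i) (v m) = v n ∨ T β (-1 - i) (v m) = v n then 1
    else 0

/-- `A_w = A_{w₁} ⋯ A_{wₙ}`. -/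
def transitionWord (β : ℝ) {k : ℕ} (v : Fin k → ℝ) (w : List ℤ) : Matrix (Fin k) (Fin k) ℝ :=
  (w.map (transition β v)).prod

/-- Mixing words: `A_w` vanishes exactly on some rows `I` and columns `J`, which do not contain the
index of the translation `0`. -/
def IsMixing (β : ℝ) {k : ℕ} (v : Fin (k + 1) → ℝ) (w : List ℤ) : Prop :=
  ∃ I J : Set (Fin (k + 1)), 0 ∉ I ∧ 0 ∉ J ∧
    ∀ i j, transitionWord β v w i j = 0 ↔ i ∈ I ∨ j ∈ J

/-- The (Hilbert--Birkhoff) projective distance of the nonnegative vectors `U, V` is finite and at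
most `c`: they have the same zero entries, and `|ln (U_i / V_i) - ln (U_j / V_j)| ≤ c` on the
other entries. -/
def ProjDistLE {k : ℕ} (U V : Fin k → ℝ) (c : ℝ) : Prop :=
  (∀ i, U i = 0 ↔ V i = 0) ∧
    ∀ i j, U i ≠ 0 → U j ≠ 0 → |Real.log (U i / V i) - Real.log (U j / V j)| ≤ c

/-- Nonnegative vectors with positive first entry. -/
def IsAdmissible {k : ℕ} (U : Fin (k + 1) → ℝ) : Prop := (∀ i, 0 ≤ U i) ∧ 0 < U 0

/-! ### Consistency checks for the definitions -/

theorem value_eq_orbit {A : Type*} [Ring A] (b : A) (c : List ℤ) :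
    value b c = orbit b c 0 := by
  suffices h : ∀ (c : List ℤ) (t : A), orbit b c t = b ^ c.length * t + value b c by
    rw [h c 0]; simp
  intro c
  induction c with
  | nil => intro t; simp [orbit, value]
  | cons i c ih =>
    intro t
    have h1 : orbit b (i :: c) t = orbit b c (T b i t) := rfl
    rw [h1, ih]
    have h2 : value b (i :: c) = (i : A) * b ^ c.length + value b c := by
      unfold value
      simp only [List.length_cons]
      rw [Fin.sum_univ_succ]
      congr 1
      refine Finset.sum_congr rfl fun j _ => ?_
      have : c.length + 1 - 1 - ((j.succ : Fin (c.length + 1)) : ℕ) = c.length - 1 - (j : ℕ) := by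
        simp only [Fin.val_succ]; omega
      rw [this]
      rfl
    rw [h2]
    unfold T
    rw [(Int.cast_commute i (b ^ c.length)).eq]
    simp only [List.length_cons, pow_succ]
    noncomm_ring

theorem T_conjC_apply (β : ℝ) (i : ℤ) (x : ContractingSpace β) (z : CPlace β) :
    ((T (conjC β) i x z : coordField (z.1 : ℂ)) : ℂ) = (z.1 : ℂ) * (x z : ℂ) + (i : ℂ) := by
  simp [T, conjC, projC, conj]

theorem summable_digits {β : ℝ} (a : ℕ → ℤ) (ha : ∀ k, IsDigit (a k)) (z : CPlace β) :
    Summable (fun k => ((a k : ℤ) : ℂ) * (z.1 : ℂ) ^ k) := by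
  refine Summable.of_norm_bounded (summable_geometric_of_lt_one (norm_nonneg _) z.2) fun k => ?_
  rcases ha k with h | h | h <;> simp [h, pow_nonneg]

theorem attractor_nonempty (β : ℝ) : (attractor β).Nonempty :=
  ⟨0, fun _ => 0, fun _ => Or.inr (Or.inl rfl), fun z => by simp⟩

theorem attractor_eq_union (β : ℝ) :
    attractor β = ⋃ i ∈ ({-1, 0, 1} : Set ℤ), T (conjC β) i '' attractor β := by
  ext x
  simp only [Set.mem_iUnion, Set.mem_image]
  constructor
  · rintro ⟨a, ha, hx⟩
    have hs : ∀ z : CPlace β, Summable (fun k => ((a (k + 1) : ℤ) : ℂ) * (z.1 : ℂ) ^ k) :=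
      fun z => summable_digits (fun k => a (k + 1)) (fun k => ha _) z
    have hmem : ∀ z : CPlace β,
        (∑' k, ((a (k + 1) : ℤ) : ℂ) * (z.1 : ℂ) ^ k) ∈ coordField (z.1 : ℂ) := by
      intro z hz
      rw [Complex.im_tsum (hs z)]
      refine (tsum_congr fun k => ?_).trans tsum_zero
      have h : ((a (k + 1) : ℤ) : ℂ) * (z.1 : ℂ) ^ k ∈ coordField (z.1 : ℂ) :=
        mul_mem (intCast_mem _ _) (pow_mem (fun h => h) _)
      exact h hz
    refine ⟨a 0, ?_, fun z => ⟨_, hmem z⟩, ⟨fun k => a (k + 1), fun k => ha _, fun z => (hs z).hasSum⟩, ?_⟩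
    · rcases ha 0 with h | h | h <;> simp [h]
    · funext z
      apply Subtype.ext
      rw [T_conjC_apply]
      have h1 := (hx z).tsum_eq
      rw [(hx z).summable.tsum_eq_zero_add] at h1
      rw [← h1, ← tsum_mul_left, add_comm]
      simp only [pow_zero, mul_one]
      congr 1
      refine tsum_congr fun k => ?_
      rw [pow_succ]; ring
  · rintro ⟨i, hi, y, ⟨a, ha, hy⟩, rfl⟩
    refine ⟨fun k => Nat.casesOn k i a, ?_, fun z => ?_⟩
    · intro k
      cases k with
      | zero => simpa [IsDigit] using hi
      | succ k => exact ha k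
    · rw [T_conjC_apply]
      rw [← hasSum_nat_add_iff' 1]
      have h := (hy z).mul_left (z.1 : ℂ)
      have e1 : (fun k => (z.1 : ℂ) * (((a k : ℤ) : ℂ) * (z.1 : ℂ) ^ k)) =
          fun k => ((a k : ℤ) : ℂ) * (z.1 : ℂ) ^ (k + 1) := by
        funext k; rw [pow_succ]; ring
      rw [e1] at h
      simpa using h

theorem attractor_isCompact (β : ℝ) : IsCompact (attractor β) := by
  let D : Set ℤ := {-1, 0, 1}
  have hD : Finite D := Set.Finite.to_subtype (by simp [D])
  have hdig : ∀ i : D, IsDigit (i : ℤ) := fun i => by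
    have h : (i : ℤ) ∈ ({-1, 0, 1} : Set ℤ) := i.2
    simpa only [IsDigit, Set.mem_insert_iff, Set.mem_singleton_iff] using h
  let F : (ℕ → D) → (CPlace β → ℂ) :=
    fun a z => ∑' k, (((a k : D) : ℤ) : ℂ) * (z.1 : ℂ) ^ k
  have hF : Continuous F := by
    refine continuous_pi fun z => ?_
    refine continuous_tsum (u := fun k => ‖(z.1 : ℂ)‖ ^ k) (fun k => ?_)
      (summable_geometric_of_lt_one (norm_nonneg _) z.2) (fun k a => ?_)
    · exact ((continuous_of_discreteTopology (f := fun i : D => (((i : ℤ)) : ℂ))).comp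
        (continuous_apply k)).mul continuous_const
    · rcases hdig (a k) with h | h | h <;> simp [h, pow_nonneg]
  have hc : IsCompact (Set.range F) := isCompact_range hF
  let ι : ContractingSpace β → (CPlace β → ℂ) := fun x z => (x z : ℂ)
  have hcl : ∀ z : CPlace β, IsClosed (coordField (z.1 : ℂ) : Set ℂ) := by
    intro z
    by_cases hz : (z.1 : ℂ).im = 0
    · have : (coordField (z.1 : ℂ) : Set ℂ) = {w | w.im = 0} := by
        ext w; exact ⟨fun h => h hz, fun h _ => h⟩
      rw [this]
      exact isClosed_eq Complex.continuous_im continuous_const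
    · have : (coordField (z.1 : ℂ) : Set ℂ) = Set.univ := by
        ext w; exact ⟨fun _ => trivial, fun _ h => absurd h hz⟩
      rw [this]; exact isClosed_univ
  have hι : IsClosedEmbedding ι := by
    refine ⟨?_, ?_⟩
    · exact Topology.IsEmbedding.piMap fun z => Topology.IsEmbedding.subtypeVal
    · have : Set.range ι = Set.pi Set.univ fun z : CPlace β => (coordField (z.1 : ℂ) : Set ℂ) := by
        ext y
        constructor
        · rintro ⟨x, rfl⟩ z _
          exact (x z).2
        · intro h
          exact ⟨fun z => ⟨y z, h z trivial⟩, rfl⟩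
      rw [this]
      exact isClosed_set_pi fun z _ => hcl z
  have : attractor β = ι ⁻¹' Set.range F := by
    ext x
    constructor
    · rintro ⟨a, ha, hx⟩
      refine ⟨fun k => ⟨a k, by simpa [D, IsDigit] using ha k⟩, ?_⟩
      funext z
      exact (hx z).tsum_eq
    · rintro ⟨a, ha⟩
      refine ⟨fun k => (a k : ℤ), fun k => hdig _, fun z => ?_⟩
      have h := congrFun ha z
      have hs := summable_digits (fun k => ((a k : D) : ℤ)) (fun k => hdig _) z
      have h2 := hs.hasSum
      have h3 : (∑' k, (((a k : D) : ℤ) : ℂ) * (z.1 : ℂ) ^ k) = (x z : ℂ) := h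
      rwa [h3] at h2
  rw [this]
  exact hι.isCompact_preimage hc

end Spectra

end

/-! Everything rests on a finiteness fact. If two points can be driven to the same place by words of
equal length, all conjugates of their difference are bounded: the contracting ones because both
points project into the bounded set 𝓡, the expanding ones because the difference must be cancelled
by a geometric sum. No conjugate has modulus 1, so only finitely many algebraic integers qualify
(`finite_differences`).

Existence of μ is a renewal argument. The count is largest at 0, by 2ab ≤ a² + b². Finiteness of Δ
makes 𝒩ₙ(0) submultiplicative up to the factor #Δ, and it is supermultiplicative anyway, so λ⁻ⁿ𝒩ₙ(0)
stays between positive constants. Splitting representations at their last visit to 0 gives a renewal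
equation, hence convergence (`renewal_tendsto`, `exists_limit`). The limit is an eigenfunction of
the transfer operator; on the vectors (μ(x + v_j))_j this says that moving x by T_i amounts to
multiplying by A_i, up to a scalar (`localVector_orbit`).

A word that sends every surviving difference to 0, followed by one whose reachable targets are all
reachable from 0, has a matrix whose non-zero entries form a product set (`isMixing_append`). Such a
matrix contracts the projective distance (`exists_contraction`).

One obstacle remains: x_c ∈ [a] does not say that x is reached along a from a point of X(β); a
priori the preimage is only an element of ℤ[β] lying over 𝓡. Therefore `RowGood` also covers
differences with such elements, and a row-good word moves the preimage into X(β)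
(`exists_preimage_in_spectrum`). Condition 1 is used only through 0 ∈ int 𝓡: enough zeros map 𝓡 into
its interior, so the estimates hold on an open neighbourhood of the cylinder and pass to limits,
which define f_j at the points of 𝓡 that are not projections of points of X(β). -/

noncomputable section

namespace Spectra

/-! ### Words and orbits -/

section Words

variable {A : Type*} [Ring A] (b : A)

@[simp] theorem orbit_nil (t : A) : orbit b [] t = t := rfl

@[simp] theorem orbit_cons (i : ℤ) (c : List ℤ) (t : A) :
    orbit b (i :: c) t = orbit b c (T b i t) := rfl

theorem orbit_append (c d : List ℤ) (t : A) : orbit b (c ++ d) t = orbit b d (orbit b c t) := by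
  simp [orbit, List.foldl_append]

@[simp] theorem value_nil : value b [] = 0 := by simp [value]

theorem orbit_sub (c : List ℤ) (s t : A) :
    orbit b c s - orbit b c t = b ^ c.length * (s - t) := by
  induction c generalizing s t with
  | nil => simp
  | cons i c ih => simp [ih, T, ← mul_sub, pow_succ, mul_assoc]

theorem orbit_eq (c : List ℤ) (t : A) : orbit b c t = b ^ c.length * t + value b c := by
  have h := orbit_sub b c t 0
  rw [value_eq_orbit, ← sub_eq_iff_eq_add, h, sub_zero]

theorem value_append (c d : List ℤ) : value b (c ++ d) = orbit b d (value b c) := by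
  simp [value_eq_orbit, orbit_append]

theorem value_cons (i : ℤ) (c : List ℤ) :
    value b (i :: c) = b ^ c.length * (i : A) + value b c := by
  rw [value_eq_orbit, orbit_cons, orbit_eq]; simp [T]

theorem value_replicate_zero (n : ℕ) : value b (List.replicate n 0) = 0 := by
  induction n with
  | zero => simp
  | succ n ih => simp [List.replicate_succ, value_cons, ih]

theorem value_zero_append (n : ℕ) (c : List ℤ) :
    value b (List.replicate n 0 ++ c) = value b c := by
  rw [value_append, value_replicate_zero, ← value_eq_orbit]

theorem map_orbit {B : Type*} [Ring B] (φ : A →+* B) (c : List ℤ) (t : A) :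
    φ (orbit b c t) = orbit (φ b) c (φ t) := by
  induction c generalizing t with
  | nil => simp
  | cons i c ih => simp [ih, T]

theorem map_value {B : Type*} [Ring B] (φ : A →+* B) (c : List ℤ) :
    φ (value b c) = value (φ b) c := by
  simp [value_eq_orbit, map_orbit]

/-- The word `e_{n-1} ⋯ e_0`. -/
def digitWord (e : ℕ → ℤ) : ℕ → List ℤ
  | 0 => []
  | n + 1 => e n :: digitWord e n

@[simp] theorem length_digitWord (e : ℕ → ℤ) (n : ℕ) : (digitWord e n).length = n := by
  induction n with
  | zero => rfl
  | succ n ih => simp [digitWord, ih]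

theorem value_digitWord (e : ℕ → ℤ) (n : ℕ) :
    value b (digitWord e n) = ∑ k ∈ Finset.range n, b ^ k * (e k : A) := by
  induction n with
  | zero => simp [digitWord]
  | succ n ih => simp [digitWord, value_cons, ih, Finset.sum_range_succ, add_comm]

end Words

theorem isDigit_zero : IsDigit 0 := Or.inr (Or.inl rfl)

theorem IsDigit.neg {i : ℤ} (h : IsDigit i) : IsDigit (-i) := by
  unfold IsDigit at *; omega

theorem IsDigit.norm_le {i : ℤ} (h : IsDigit i) : ‖(i : ℂ)‖ ≤ 1 := by
  rcases h with rfl | rfl | rfl <;> simp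

theorem isWord_nil : IsWord [] := by simp [IsWord]

@[simp] theorem isWord_cons {i : ℤ} {c : List ℤ} : IsWord (i :: c) ↔ IsDigit i ∧ IsWord c := by
  simp [IsWord]

@[simp] theorem isWord_append {c d : List ℤ} : IsWord (c ++ d) ↔ IsWord c ∧ IsWord d := by
  simp only [IsWord, List.mem_append]
  exact ⟨fun h => ⟨fun i hi => h i (Or.inl hi), fun i hi => h i (Or.inr hi)⟩,
    fun h i hi => hi.elim (h.1 i) (h.2 i)⟩

@[simp] theorem isWord_reverse {c : List ℤ} : IsWord c.reverse ↔ IsWord c := by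
  simp [IsWord]

theorem isWord_replicate (n : ℕ) : IsWord (List.replicate n 0) := by
  intro i hi
  rw [List.eq_of_mem_replicate hi]
  exact isDigit_zero

theorem isWord_digitWord {e : ℕ → ℤ} (n : ℕ) (he : ∀ k, IsDigit (e k)) :
    IsWord (digitWord e n) := by
  induction n with
  | zero => exact isWord_nil
  | succ n ih => exact isWord_cons.2 ⟨he n, ih⟩

/-! ### The spectrum and the cylinders -/

theorem zero_mem_spectrum (β : ℝ) : (0 : ℝ) ∈ spectrum β := ⟨[], isWord_nil, by simp⟩

theorem value_mem_spectrum (β : ℝ) {c : List ℤ} (hc : IsWord c) : value β c ∈ spectrum β :=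
  ⟨c, hc, rfl⟩

theorem orbit_mem_spectrum {β : ℝ} {c : List ℤ} (hc : IsWord c) {x : ℝ} (hx : x ∈ spectrum β) :
    orbit β c x ∈ spectrum β := by
  obtain ⟨d, hd, rfl⟩ := hx
  exact ⟨d ++ c, isWord_append.2 ⟨hd, hc⟩, (value_append β d c).symm⟩

theorem T_mem_spectrum {β : ℝ} {i : ℤ} (hi : IsDigit i) {x : ℝ} (hx : x ∈ spectrum β) :
    T β i x ∈ spectrum β :=
  orbit_mem_spectrum (c := [i]) (by simp [hi, isWord_nil]) hx

/-- Every point of the spectrum is the image of another one under a word of given length. -/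
theorem exists_orbit_of_mem_spectrum {β x : ℝ} (hx : x ∈ spectrum β) (n : ℕ) :
    ∃ c : List ℤ, IsWord c ∧ c.length = n ∧ ∃ y ∈ spectrum β, x = orbit β c y := by
  obtain ⟨d, hd, rfl⟩ := hx
  -- Leading zeros do not change the value, and they make the word long enough for its last `n`
  -- letters to be split off.
  set e := List.replicate n 0 ++ d with he
  have hw : IsWord e := isWord_append.2 ⟨isWord_replicate n, hd⟩
  have hl : e.length = n + d.length := by simp [he]
  have hsplit := List.take_append_drop d.length e
  rw [← hsplit, isWord_append] at hw
  refine ⟨e.drop d.length, hw.2, by simp [hl], value β (e.take d.length), ⟨_, hw.1, rfl⟩, ?_⟩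
  rw [← value_append, hsplit, he, value_zero_append]

theorem cylinder_eq (β : ℝ) (a : List ℤ) :
    cylinder β a = orbit (conjC β) a.reverse '' attractor β := by
  induction a with
  | nil => exact (Set.image_id _).symm
  | cons i a ih =>
    have : cylinder β (i :: a) = T (conjC β) i '' cylinder β a := rfl
    rw [this, ih, Set.image_image]
    refine Set.image_congr fun x _ => ?_
    rw [List.reverse_cons, orbit_append, orbit_cons, orbit_nil]

theorem T_mem_attractor {β : ℝ} {i : ℤ} (hi : IsDigit i) {x : ContractingSpace β}
    (hx : x ∈ attractor β) : T (conjC β) i x ∈ attractor β := by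
  rw [attractor_eq_union]
  simp only [Set.mem_iUnion]
  exact ⟨i, hi, x, hx, rfl⟩

theorem orbit_mem_attractor {β : ℝ} {c : List ℤ} (hc : IsWord c) {x : ContractingSpace β}
    (hx : x ∈ attractor β) : orbit (conjC β) c x ∈ attractor β := by
  induction c generalizing x with
  | nil => exact hx
  | cons i c ih =>
    rw [isWord_cons] at hc
    exact ih hc.2 (T_mem_attractor hc.1 hx)

theorem zero_mem_attractor (β : ℝ) : (0 : ContractingSpace β) ∈ attractor β :=
  ⟨fun _ => 0, fun _ => isDigit_zero, fun z => by simp⟩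

theorem value_mem_attractor {β : ℝ} {c : List ℤ} (hc : IsWord c) :
    value (conjC β) c ∈ attractor β := by
  rw [value_eq_orbit]
  exact orbit_mem_attractor hc (zero_mem_attractor β)

theorem norm_apply_le_of_mem_attractor {β : ℝ} {x : ContractingSpace β} (hx : x ∈ attractor β)
    (z : CPlace β) : ‖(x z : ℂ)‖ ≤ (1 - ‖(z.1 : ℂ)‖)⁻¹ := by
  obtain ⟨a, ha, h⟩ := hx
  refine (h z).norm_le_of_bounded (hasSum_geometric_of_lt_one (norm_nonneg _) z.2) fun k => ?_
  rw [norm_mul, norm_pow]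
  exact mul_le_of_le_one_left (by positivity) (ha k).norm_le

/-- The points of the spectrum are dense in the attractor. -/
theorem exists_value_mem_of_mem_nhds {β : ℝ} {p : ContractingSpace β} (hp : p ∈ attractor β)
    {O : Set (ContractingSpace β)} (hO : O ∈ 𝓝 p) :
    ∃ c : List ℤ, IsWord c ∧ value (conjC β) c ∈ O := by
  obtain ⟨a, ha, h⟩ := hp
  have : Tendsto (fun n => value (conjC β) (digitWord a n)) atTop (𝓝 p) := by
    rw [tendsto_pi_nhds]
    intro z
    rw [tendsto_subtype_rng]
    refine (h z).tendsto_sum_nat.congr fun n => ?_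
    rw [value_digitWord]
    simp [conjC, projC, conj, mul_comm]
  obtain ⟨n, hn⟩ := (this.eventually hO).exists
  exact ⟨_, isWord_digitWord n ha, hn⟩

/-! ### Galois conjugates -/

section Conjugates

open Polynomial

variable {β : ℝ}

theorem aeval_value_X {A : Type*} [Ring A] (b : A) (c : List ℤ) :
    aeval b (value (X : ℤ[X]) c) = value b c := by
  have := map_value (X : ℤ[X]) (aeval b : ℤ[X] →ₐ[ℤ] A).toRingHom c
  simpa using this

theorem aeval_conj_eq_zero {P : ℤ[X]} (hP : aeval β P = 0) {z : ℂ}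
    (hz : z ∈ (minpoly ℚ β).rootSet ℂ) : aeval z P = 0 := by
  have h1 : aeval β (P.map (algebraMap ℤ ℚ)) = 0 := by rwa [aeval_map_algebraMap]
  obtain ⟨Q, hQ⟩ := minpoly.dvd ℚ β h1
  have h2 : aeval z (P.map (algebraMap ℤ ℚ)) = 0 := by
    rw [hQ, map_mul, aeval_eq_zero_of_mem_rootSet hz, zero_mul]
  rwa [aeval_map_algebraMap] at h2

theorem aeval_conj_eq {P Q : ℤ[X]} (h : aeval β P = aeval β Q) {z : ℂ}
    (hz : z ∈ (minpoly ℚ β).rootSet ℂ) : aeval z P = aeval z Q := by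
  have := aeval_conj_eq_zero (P := P - Q) (by simp [h]) hz
  simpa [sub_eq_zero] using this

theorem aeval_eq_zero_of_conj (hβ : IsIntegral ℤ β) {P : ℤ[X]} {z : ℂ}
    (hz : z ∈ (minpoly ℚ β).rootSet ℂ) (hP : aeval z P = 0) : aeval β P = 0 := by
  have hint : IsIntegral ℚ β := hβ.tower_top
  have hmin : minpoly ℚ β = minpoly ℚ z :=
    minpoly.eq_of_irreducible_of_monic (minpoly.irreducible hint)
      (aeval_eq_zero_of_mem_rootSet hz) (minpoly.monic hint)
  have h1 : aeval z (P.map (algebraMap ℤ ℚ)) = 0 := by rwa [aeval_map_algebraMap]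
  obtain ⟨Q, hQ⟩ := minpoly.dvd ℚ z h1
  have h2 : aeval β (P.map (algebraMap ℤ ℚ)) = 0 := by
    rw [hQ, ← hmin, map_mul, minpoly.aeval, zero_mul]
  rwa [aeval_map_algebraMap] at h2

/-- A number in `ℤ[β]` is determined up to finitely many choices by a bound on its conjugates. -/
theorem finite_of_conj_norm_le (hβ : IsIntegral ℤ β) (M : ℝ) :
    {y : ℝ | ∃ P : ℤ[X], aeval β P = y ∧
      ∀ z ∈ (minpoly ℚ β).rootSet ℂ, ‖aeval z P‖ ≤ M}.Finite := by
  have hint : IsIntegral ℚ β := hβ.tower_top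
  let K := IntermediateField.adjoin ℚ {β}
  have : FiniteDimensional ℚ K := IntermediateField.adjoin.finiteDimensional hint
  have : NumberField K := ⟨⟩
  let g : K := IntermediateField.AdjoinSimple.gen ℚ β
  have hg : (g : ℝ) = β := IntermediateField.AdjoinSimple.coe_gen ℚ β
  have hgi : IsIntegral ℤ g := by
    rw [← isIntegral_algebraMap_iff (B := ℝ) (Subtype.val_injective)]
    exact hβ
  refine ((NumberField.Embeddings.finite_of_norm_le K ℂ M).image
    (fun x : K => (x : ℝ))).subset ?_
  rintro y ⟨P, rfl, hP⟩
  refine ⟨aeval g P, ⟨?_, fun φ => ?_⟩, ?_⟩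
  · have : aeval g P ∈ integralClosure ℤ K := by
      have h := (aeval (R := ℤ) (⟨g, hgi⟩ : integralClosure ℤ K) P).2
      rwa [← Subalgebra.coe_val, ← aeval_algHom_apply] at h
    exact this
  -- A complex embedding of ℚ(β) sends β to a root of its minimal polynomial, so the bound at the
  -- roots is a bound at all embeddings.
  · have h1 : φ (aeval g P) = aeval (φ g) P := by
      have := (aeval_algHom_apply φ.toIntAlgHom g P).symm
      simpa using this
    rw [h1]
    refine hP _ ?_
    rw [mem_rootSet]
    refine ⟨minpoly.ne_zero hint, ?_⟩
    have h2 : aeval g (minpoly ℚ β) = 0 := by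
      apply Subtype.val_injective
      have := aeval_algHom_apply (IntermediateField.val K) g (minpoly ℚ β)
      rw [IntermediateField.coe_val] at this
      rw [← this, hg, minpoly.aeval]; rfl
    have h3 := aeval_algHom_apply φ.toRatAlgHom g (minpoly ℚ β)
    rw [h2, map_zero] at h3
    exact h3
  · have := aeval_algHom_apply ((IntermediateField.val K).restrictScalars ℤ) g P
    simp only [AlgHom.coe_restrictScalars', IntermediateField.coe_val] at this
    rw [hg] at this
    exact this.symm

/-- After cancelling powers of `X` the constant coefficient is ±1, which makes β a unit of ℤ[β]. -/
theorem exists_inverse_of_digits (hβ0 : β ≠ 0) {n : ℕ} {p : ℤ[X]} (hn : p.natDegree ≤ n)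
    (h0 : p ≠ 0)
    (hd : ∀ k, IsDigit (p.coeff k)) (hp : aeval β p = 0) :
    ∃ Q : ℤ[X], β * aeval β Q = 1 := by
  induction n generalizing p with
  | zero =>
    obtain ⟨a, rfl⟩ := natDegree_eq_zero.1 (Nat.le_zero.1 hn)
    rw [aeval_C, algebraMap_int_eq, eq_intCast, Int.cast_eq_zero] at hp
    simp [hp] at h0
  | succ n ih =>
    have h1 := divX_mul_X_add p
    have h2 : aeval β p.divX * β + (p.coeff 0 : ℝ) = 0 := by
      rw [← h1] at hp
      simpa using hp
    rcases hd 0 with h | h | h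
    · refine ⟨p.divX, ?_⟩
      rw [h] at h2; push_cast at h2; linarith
    · rw [h] at h2
      rw [h, C_0, add_zero] at h1
      have h3 : p.divX ≠ 0 := by
        intro h4; rw [h4, zero_mul] at h1; exact h0 h1.symm
      refine ih ?_ h3 (fun k => by rw [coeff_divX]; exact hd _) ?_
      · rw [natDegree_divX_eq_natDegree_tsub_one]; omega
      · simpa [hβ0] using h2
    · refine ⟨-p.divX, ?_⟩
      rw [h] at h2; push_cast at h2; simp only [map_neg]; linarith

end Conjugates

/-! ### Units, the image of ℤ[β] in the contracting space, and differences -/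

section Lattice

open Polynomial

variable {β : ℝ}

theorem IsHyperbolic.pos (hβ : IsHyperbolic β) : 0 < β := one_pos.trans hβ.one_lt

theorem IsHyperbolic.exists_inverse (hβ : IsHyperbolic β) :
    ∃ Q : ℤ[X], β * aeval β Q = 1 := by
  obtain ⟨p, h0, hd, hp⟩ := hβ.exists_poly
  exact exists_inverse_of_digits hβ.pos.ne' le_rfl h0 hd hp

/-- The coordinate homomorphisms of the contracting space. -/
def coord (β : ℝ) (z : CPlace β) : ContractingSpace β →+* ℂ :=
  (coordField (z.1 : ℂ)).val.toRingHom.comp (Pi.evalRingHom _ z)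

theorem coord_apply (z : CPlace β) (x : ContractingSpace β) : coord β z x = (x z : ℂ) := rfl

theorem coord_conjC (z : CPlace β) : coord β z (conjC β) = (z.1 : ℂ) := rfl

theorem ext_coord {x y : ContractingSpace β} (h : ∀ z, coord β z x = coord β z y) : x = y :=
  funext fun z => Subtype.ext (h z)

theorem coord_aeval (z : CPlace β) (P : ℤ[X]) :
    coord β z (aeval (conjC β) P) = aeval (z.1 : ℂ) P := by
  have := (aeval_algHom_apply (coord β z).toIntAlgHom (conjC β) P).symm
  simpa [coord_conjC] using this

theorem aeval_conjC_eq {P Q : ℤ[X]} (h : aeval β P = aeval β Q) :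
    aeval (conjC β) P = aeval (conjC β) Q :=
  ext_coord fun z => by rw [coord_aeval, coord_aeval, aeval_conj_eq h z.1.2.1]

theorem star_mem_rootSet {z : ℂ} (hz : z ∈ (minpoly ℚ β).rootSet ℂ) :
    (starRingEnd ℂ) z ∈ (minpoly ℚ β).rootSet ℂ := by
  rw [mem_rootSet] at hz ⊢
  refine ⟨hz.1, ?_⟩
  have := aeval_algHom_apply (starRingEnd ℂ).toRatAlgHom z (minpoly ℚ β)
  rw [hz.2, map_zero] at this
  exact this

theorem norm_aeval_star (z : ℂ) (P : ℤ[X]) :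
    ‖aeval ((starRingEnd ℂ) z) P‖ = ‖aeval z P‖ := by
  have := aeval_algHom_apply (starRingEnd ℂ).toIntAlgHom z P
  have h2 : aeval ((starRingEnd ℂ) z) P = (starRingEnd ℂ) (aeval z P) := this
  rw [h2, Complex.norm_conj]

/-- Reduction of a statement about norms at the contracting conjugates to the places. -/
theorem norm_aeval_le_of_places {P : ℤ[X]} {M : ℂ → ℝ}
    (hM : ∀ z, M ((starRingEnd ℂ) z) = M z)
    (h : ∀ z : CPlace β, ‖aeval (z.1 : ℂ) P‖ ≤ M z.1) {z : ℂ}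
    (hz : z ∈ (minpoly ℚ β).rootSet ℂ) (h1 : ‖z‖ < 1) : ‖aeval z P‖ ≤ M z := by
  rcases le_total 0 z.im with h0 | h0
  · exact h ⟨⟨z, hz, h0⟩, h1⟩
  · have := h ⟨⟨(starRingEnd ℂ) z, star_mem_rootSet hz, by simpa using h0⟩, by simpa using h1⟩
    rwa [norm_aeval_star, hM] at this

/-- Otherwise all conjugates of the unit β⁻¹ have modulus at most 1, and its infinitely many
distinct powers contradict `finite_of_conj_norm_le`. -/
theorem IsHyperbolic.nonempty_cPlace (hβ : IsHyperbolic β) : Nonempty (CPlace β) := by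
  by_contra hne
  have h1 : ∀ z ∈ (minpoly ℚ β).rootSet ℂ, 1 ≤ ‖z‖ := by
    intro z hz
    by_contra! hlt
    refine hne ?_
    rcases le_total 0 z.im with h0 | h0
    · exact ⟨⟨⟨z, hz, h0⟩, hlt⟩⟩
    · exact ⟨⟨⟨(starRingEnd ℂ) z, star_mem_rootSet hz, by simpa using h0⟩, by simpa using hlt⟩⟩
  obtain ⟨Q, hQ⟩ := hβ.exists_inverse
  have hfin := finite_of_conj_norm_le hβ.isIntegral 1
  have hQ' : aeval β Q = β⁻¹ := eq_inv_of_mul_eq_one_right hQ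
  refine (Set.infinite_range_of_injective
    (pow_right_injective₀ (inv_pos.2 hβ.pos) (inv_lt_one_of_one_lt₀ hβ.one_lt).ne)) (hfin.subset ?_)
  rintro _ ⟨n, rfl⟩
  refine ⟨Q ^ n, by simp [hQ'], fun z hz => ?_⟩
  have h2 : aeval z (X * Q) = aeval z (1 : ℤ[X]) := aeval_conj_eq (by simp [hQ]) hz
  have h3 : ‖z‖ * ‖aeval z Q‖ = 1 := by
    have h2 : z * aeval z Q = 1 := by simpa using h2
    rw [← norm_mul, h2, norm_one]
  rw [map_pow, norm_pow]
  refine pow_le_one₀ (norm_nonneg _) ?_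
  nlinarith [h1 z hz, norm_nonneg (aeval z Q)]

/-- `y ∈ ℤ[β]` has the image `q` in the contracting space. -/
def Lifts (β : ℝ) (y : ℝ) (q : ContractingSpace β) : Prop :=
  ∃ P : ℤ[X], aeval β P = y ∧ aeval (conjC β) P = q

theorem lifts_value (c : List ℤ) : Lifts β (value β c) (value (conjC β) c) :=
  ⟨value X c, aeval_value_X _ _, aeval_value_X _ _⟩

/-- A single conjugate determines an element of ℤ[β], and at least one conjugate is contracting.
This is why f_j can be a function of x_c. -/
theorem Lifts.injective (hβ : IsHyperbolic β) {y y' : ℝ} {q : ContractingSpace β}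
    (h : Lifts β y q) (h' : Lifts β y' q) : y = y' := by
  obtain ⟨P, rfl, rfl⟩ := h
  obtain ⟨P', rfl, h1⟩ := h'
  obtain ⟨z⟩ := hβ.nonempty_cPlace
  have h2 : aeval (z.1 : ℂ) (P - P') = 0 := by
    rw [map_sub, ← coord_aeval, ← coord_aeval, h1, sub_self]
  have := aeval_eq_zero_of_conj hβ.isIntegral z.1.2.1 h2
  simpa [sub_eq_zero] using this

theorem Lifts.orbit {y : ℝ} {q : ContractingSpace β} (h : Lifts β y q) (c : List ℤ) :
    Lifts β (orbit β c y) (orbit (conjC β) c q) := by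
  obtain ⟨P, rfl, rfl⟩ := h
  refine ⟨Spectra.orbit X c P, ?_, ?_⟩
  · have := map_orbit (X : ℤ[X]) (aeval β : ℤ[X] →ₐ[ℤ] ℝ).toRingHom c P
    simpa using this
  · have := map_orbit (X : ℤ[X]) (aeval (conjC β) : ℤ[X] →ₐ[ℤ] _).toRingHom c P
    simpa using this

theorem conjC_mul_inverse {Q : ℤ[X]} (hQ : β * aeval β Q = 1) :
    conjC β * aeval (conjC β) Q = 1 := by
  have := aeval_conjC_eq (P := X * Q) (Q := 1) (by simpa using hQ)
  simpa using this

/-- Since β is a unit, each T_i is a bijection of ℤ[β]. The preimage need not belong to the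
spectrum. -/
theorem Lifts.exists_preimage (hβ : IsHyperbolic β) {x : ℝ} {c : List ℤ} {r : ContractingSpace β}
    (h : Lifts β x (Spectra.orbit (conjC β) c r)) :
    ∃ y, Lifts β y r ∧ x = Spectra.orbit β c y := by
  obtain ⟨Q, hQ⟩ := hβ.exists_inverse
  have hQ' := conjC_mul_inverse hQ
  induction c generalizing r with
  | nil => exact ⟨x, h, rfl⟩
  | cons i c ih =>
    obtain ⟨y, ⟨P, hP1, hP2⟩, hy⟩ := ih h
    refine ⟨aeval β (Q * (P - (i : ℤ[X]))), ⟨_, rfl, ?_⟩, ?_⟩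
    · simp only [map_mul, map_sub, map_intCast, hP2, T]
      linear_combination r * hQ'
    · rw [orbit_cons, hy]
      congr 1
      simp only [map_mul, map_sub, map_intCast, hP1, T]
      linear_combination (-(y - i)) * hQ

/-! ### Coalescing differences -/

/-- A pair of points with difference `u` can be moved to a pair with difference `u'` such that the
second point moves along the word `w`. -/
def Reach {A : Type*} [Ring A] (b : A) (w : List ℤ) (u u' : A) : Prop :=
  ∃ c : List ℤ, IsWord c ∧ c.length = w.length ∧ u' + value b w = orbit b c u

theorem orbit_add {A : Type*} [Ring A] (b : A) (c : List ℤ) (s t : A) :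
    orbit b c (s + t) = b ^ c.length * s + orbit b c t := by
  rw [orbit_eq, orbit_eq b c t, mul_add]; abel

/-- The maps are affine with a common linear part, so only the difference of the two points matters
and the base point `x` is arbitrary. -/
theorem reach_iff {A : Type*} [Ring A] {b : A} {w : List ℤ} {u u' : A} (x : A) :
    Reach b w u u' ↔ ∃ c : List ℤ, IsWord c ∧ c.length = w.length ∧
      orbit b c (x + u) = orbit b w x + u' := by
  unfold Reach
  refine exists_congr fun c => and_congr_right fun _ => and_congr_right fun hc => ?_
  rw [orbit_add, orbit_eq b w x, hc, add_assoc, add_right_inj, add_comm, eq_comm]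

theorem reach_nil {A : Type*} [Ring A] {b : A} {u u' : A} : Reach b [] u u' ↔ u' = u := by
  constructor
  · rintro ⟨c, _, hl, h⟩
    rw [List.length_nil, List.length_eq_zero_iff] at hl
    simpa [hl] using h
  · rintro rfl
    exact ⟨[], isWord_nil, rfl, by simp⟩

theorem reach_singleton {A : Type*} [Ring A] {b : A} {i : ℤ} {u u' : A} :
    Reach b [i] u u' ↔ ∃ d, IsDigit d ∧ T b (d - i) u = u' := by
  constructor
  · rintro ⟨c, hc, hl, h⟩
    obtain ⟨d, rfl⟩ := List.length_eq_one_iff.1 hl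
    refine ⟨d, (isWord_cons.1 hc).1, ?_⟩
    simp only [value_cons, List.length_nil, pow_zero, one_mul, value_nil, add_zero, orbit_cons,
      orbit_nil, T] at h
    simp only [T, Int.cast_sub]
    rw [← add_sub_assoc, ← h, add_sub_cancel_right]
  · rintro ⟨d, hd, rfl⟩
    refine ⟨[d], by simp [hd, isWord_nil], rfl, ?_⟩
    simp only [value_cons, List.length_nil, pow_zero, one_mul, value_nil, add_zero, orbit_cons,
      orbit_nil, T, Int.cast_sub]
    rw [add_assoc, sub_add_cancel]

theorem reach_append {A : Type*} [Ring A] {b : A} {v w : List ℤ} {u u' : A} :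
    Reach b (v ++ w) u u' ↔ ∃ t, Reach b v u t ∧ Reach b w t u' := by
  constructor
  · rintro ⟨c, hc, hl, h⟩
    rw [List.length_append] at hl
    have hsplit := List.take_append_drop v.length c
    rw [← hsplit, isWord_append] at hc
    have hl1 : (c.take v.length).length = v.length := by simp [hl]
    refine ⟨orbit b (c.take v.length) u - value b v, ⟨_, hc.1, hl1, by simp⟩, ?_⟩
    refine (reach_iff (value b v)).2 ⟨_, hc.2, by simp [hl], ?_⟩
    rw [add_sub_cancel, ← orbit_append, hsplit, ← h, value_append, add_comm]
  · rintro ⟨t, ⟨c, hc, hl, h⟩, h2⟩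
    obtain ⟨d, hd, hl2, h3⟩ := (reach_iff (value b v)).1 h2
    refine ⟨c ++ d, isWord_append.2 ⟨hc, hd⟩, by simp [hl, hl2], ?_⟩
    rw [orbit_append, ← h, add_comm t, h3, value_append, add_comm]

theorem reach_zero_zero {A : Type*} [Ring A] (b : A) {w : List ℤ} (hw : IsWord w) :
    Reach b w 0 0 := ⟨w, hw, rfl, by rw [zero_add, value_eq_orbit]⟩

/-- The differences of points of the spectrum and points of `ℤ[β]` over the attractor which can be
moved to `0`. -/
def differences (β : ℝ) : Set ℝ :=
  {u | ∃ x ∈ spectrum β, ∃ y q, Lifts β y q ∧ q ∈ attractor β ∧ u = x - y ∧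
    ∃ w, IsWord w ∧ Reach β w u 0}

theorem norm_value_le {z : ℂ} (hz : 1 < ‖z‖) {c : List ℤ} (hc : IsWord c) :
    ‖value z c‖ ≤ ‖z‖ ^ c.length / (‖z‖ - 1) := by
  have h0 : 0 < ‖z‖ - 1 := by linarith
  induction c with
  | nil => simp [h0.le]
  | cons i c ih =>
    rw [isWord_cons] at hc
    rw [value_cons]
    refine (norm_add_le _ _).trans ?_
    rw [norm_mul, norm_pow, List.length_cons]
    have h1 : ‖z‖ ^ c.length * ‖(i : ℂ)‖ ≤ ‖z‖ ^ c.length :=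
      mul_le_of_le_one_right (by positivity) hc.1.norm_le
    have h2 : ‖z‖ ^ (c.length + 1) / (‖z‖ - 1) = ‖z‖ ^ c.length + ‖z‖ ^ c.length / (‖z‖ - 1) := by
      field_simp; ring
    rw [h2]
    exact add_le_add h1 (ih hc.2)

/-- Each conjugate z of such a difference u is bounded by 2 / ||z| - 1|: for |z| < 1 by the size of
the attractor, for |z| > 1 by comparing the two words that cancel u. -/
theorem finite_differences (hβ : IsHyperbolic β) : (differences β).Finite := by
  obtain ⟨M, hM⟩ := ((Polynomial.rootSet_finite (minpoly ℚ β) ℂ).image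
    fun z => 2 * |‖z‖ - 1|⁻¹).bddAbove
  refine (finite_of_conj_norm_le hβ.isIntegral M).subset ?_
  rintro u ⟨_, ⟨c, hc, rfl⟩, y, q, ⟨P, rfl, rfl⟩, hq, rfl, w, hw, d, hd, hl, h⟩
  refine ⟨value X c - P, by rw [map_sub, aeval_value_X], fun z hz => ?_⟩
  refine le_trans ?_ (hM ⟨z, hz, rfl⟩)
  rcases lt_or_gt_of_ne (hβ.norm_ne_one z hz) with h1 | h1
  · refine norm_aeval_le_of_places (M := fun z => 2 * |‖z‖ - 1|⁻¹) (by simp) (fun z => ?_) hz h1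
    rw [map_sub, aeval_value_X]
    have e1 := norm_apply_le_of_mem_attractor (value_mem_attractor hc) z
    have e2 := norm_apply_le_of_mem_attractor hq z
    rw [← coord_apply, coord_aeval] at e2
    rw [← coord_apply, map_value, coord_conjC] at e1
    have e3 : |‖(z.1 : ℂ)‖ - 1| = 1 - ‖(z.1 : ℂ)‖ := by
      rw [abs_of_neg (by linarith [z.2])]; ring
    rw [e3]
    refine (norm_sub_le _ _).trans ?_
    linarith
  -- The coalescence relation over β is a polynomial identity, hence holds at z; it expresses zⁿu as
  -- the difference of the values of two words of length n.
  · have h2 : aeval z (orbit X d (value X c - P)) = aeval z (value X w : ℤ[X]) := by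
      refine aeval_conj_eq ?_ hz
      have e := map_orbit (X : ℤ[X]) (aeval β : ℤ[X] →ₐ[ℤ] ℝ).toRingHom d (value X c - P)
      simp only [AlgHom.toRingHom_eq_coe, RingHom.coe_coe, aeval_X, map_sub, aeval_value_X] at e
      rw [e, aeval_value_X, ← h, zero_add]
    have e := map_orbit (X : ℤ[X]) (aeval z : ℤ[X] →ₐ[ℤ] ℂ).toRingHom d (value X c - P)
    simp only [AlgHom.toRingHom_eq_coe, RingHom.coe_coe, aeval_X] at e
    rw [e, aeval_value_X, orbit_eq] at h2
    have h3 : z ^ d.length * aeval z (value X c - P) = value z w - value z d := by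
      rw [← h2]; ring
    have h4 := norm_value_le h1 hw
    have h5 := norm_value_le h1 hd
    have h6 := congrArg norm h3
    rw [norm_mul, norm_pow] at h6
    rw [← hl] at h4
    have h7 := norm_sub_le (value z w) (value z d)
    have h8 : 0 < ‖z‖ ^ d.length := by positivity
    have h9 : |‖z‖ - 1| = ‖z‖ - 1 := abs_of_pos (by linarith)
    simp only [h9]
    rw [← h6] at h7
    refine le_of_mul_le_mul_left (h7.trans ?_) h8
    calc _ ≤ _ := add_le_add h4 h5
      _ = _ := by ring

theorem differences_of_reach {u u' : ℝ} {w v : List ℤ} (hu : u ∈ differences β) (hw : IsWord w)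
    (h : Reach β w u u') (hv : IsWord v) (h' : Reach β v u' 0) : u' ∈ differences β := by
  obtain ⟨x, hx, y, q, hy, hq, rfl, -⟩ := hu
  obtain ⟨c, hc, -, h1⟩ := (reach_iff y).1 h
  rw [add_sub_cancel] at h1
  exact ⟨_, orbit_mem_spectrum hc hx, _, _, hy.orbit w, orbit_mem_attractor hw hq,
    by rw [h1]; ring, v, hv, h'⟩

/-- Membership in Δ depends on the difference only, whichever pair of spectrum points represents it.
-/
theorem mem_translations_iff {x y : ℝ} (hx : x ∈ spectrum β) (hy : y ∈ spectrum β) :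
    x - y ∈ translations β ↔ ∃ w, IsWord w ∧ Reach β w (x - y) 0 := by
  constructor
  · rintro ⟨x', hx', y', hy', h, c, d, hc, hd, hl, hcd⟩
    refine ⟨d, hd, (reach_iff y').2 ⟨c, hc, hl, ?_⟩⟩
    rw [h, add_sub_cancel, hcd, add_zero]
  · rintro ⟨w, hw, h⟩
    obtain ⟨c, hc, hl, h⟩ := (reach_iff y).1 h
    rw [add_sub_cancel, add_zero] at h
    exact ⟨x, hx, y, hy, rfl, c, w, hc, hw, hl, h⟩

theorem translations_subset : translations β ⊆ differences β := by
  rintro t ⟨x, hx, y, hy, rfl, h⟩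
  have h1 := (mem_translations_iff hx hy).1 ⟨x, hx, y, hy, rfl, h⟩
  obtain ⟨c, hc, rfl⟩ := hy
  exact ⟨x, hx, _, _, lifts_value c, value_mem_attractor hc, rfl, h1⟩

theorem zero_mem_translations : (0 : ℝ) ∈ translations β := by
  have h := zero_mem_spectrum β
  have := (mem_translations_iff h h).2 ⟨[], isWord_nil, by simp [reach_nil]⟩
  simpa using this

theorem neg_mem_translations {t : ℝ} (h : t ∈ translations β) : -t ∈ translations β := by
  obtain ⟨x, hx, y, hy, rfl, c, d, hc, hd, hl, hcd⟩ := h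
  exact ⟨y, hy, x, hx, by ring, d, c, hd, hc, hl.symm, hcd.symm⟩

/-- Translations are closed under moves that can be continued to `0`. -/
theorem translations_of_reach {u u' : ℝ} {w v : List ℤ} (hu : u ∈ translations β) (hw : IsWord w)
    (h : Reach β w u u') (hv : IsWord v) (h' : Reach β v u' 0) : u' ∈ translations β := by
  obtain ⟨x, hx, y, hy, rfl, -⟩ := hu
  obtain ⟨c, hc, -, h1⟩ := (reach_iff y).1 h
  rw [add_sub_cancel] at h1
  have : u' = orbit β c x - orbit β w y := by rw [h1]; ring
  rw [this] at h' ⊢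
  exact (mem_translations_iff (orbit_mem_spectrum hc hx) (orbit_mem_spectrum hw hy)).2 ⟨v, hv, h'⟩

/-! ### Connectedness of the spectrum -/

theorem one_mem_spectrum : (1 : ℝ) ∈ spectrum β :=
  ⟨[1], by simp [isWord_nil, IsDigit], by simp [value_cons]⟩

/-- Normalise the polynomial with root β to leading coefficient 1. Its remaining coefficients, read
as digits, take 1 to p(β) = 0, while the zero word keeps 0 at 0. -/
theorem one_mem_translations (hβ : IsHyperbolic β) : (1 : ℝ) ∈ translations β := by
  obtain ⟨p, h0, hd, hp⟩ := hβ.exists_poly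
  have hlead : p.leadingCoeff * p.leadingCoeff = 1 := by
    have h1 : p.leadingCoeff ≠ 0 := leadingCoeff_ne_zero.2 h0
    rcases hd p.natDegree with h | h | h <;> rw [coeff_natDegree] at h
    · rw [h]; norm_num
    · exact absurd h h1
    · rw [h]; norm_num
  set a := p.leadingCoeff with ha
  have hda : ∀ k, IsDigit (a * p.coeff k) := by
    intro k
    have h1 := hd p.natDegree
    rw [coeff_natDegree, ← ha] at h1
    rcases h1 with h | h | h <;> rw [h]
    · simpa using (hd k).neg
    · simpa using isDigit_zero
    · simpa using hd k
  refine ⟨1, one_mem_spectrum, 0, zero_mem_spectrum β, by simp,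
    digitWord (fun k => a * p.coeff k) p.natDegree, List.replicate p.natDegree 0,
    isWord_digitWord _ hda, isWord_replicate _, by simp, ?_⟩
  rw [← value_eq_orbit, value_replicate_zero, orbit_eq, value_digitWord, length_digitWord]
  rw [aeval_eq_sum_range, Finset.sum_range_succ, coeff_natDegree, ← ha] at hp
  have h2 : (a : ℝ) * a = 1 := by exact_mod_cast hlead
  have h3 : ∑ k ∈ Finset.range p.natDegree, β ^ k * ((a * p.coeff k : ℤ) : ℝ) =
      a * ∑ k ∈ Finset.range p.natDegree, p.coeff k • β ^ k := by
    rw [Finset.mul_sum]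
    refine Finset.sum_congr rfl fun k _ => ?_
    rw [zsmul_eq_mul]; push_cast; ring
  rw [h3]
  rw [zsmul_eq_mul] at hp
  linear_combination (a : ℝ) * hp - β ^ p.natDegree * h2

/-- Two points of the spectrum which differ by a translation. -/
def Adjacent (β y z : ℝ) : Prop :=
  y ∈ spectrum β ∧ z ∈ spectrum β ∧ z - y ∈ translations β

theorem Adjacent.symm {y z : ℝ} (h : Adjacent β y z) : Adjacent β z y :=
  ⟨h.2.1, h.1, by simpa using neg_mem_translations h.2.2⟩

theorem chain_digit (hβ : IsHyperbolic β) {t : ℝ} (ht : t ∈ spectrum β) {i j : ℤ} (hi : IsDigit i)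
    (hj : IsDigit j) : Relation.ReflTransGen (Adjacent β) (T β i t) (T β j t) := by
  have key : ∀ i, IsDigit i → Relation.ReflTransGen (Adjacent β) (T β i t) (T β 0 t) := by
    intro i hi
    by_cases h0 : i = 0
    · rw [h0]
    · refine Relation.ReflTransGen.single
        ⟨T_mem_spectrum hi ht, T_mem_spectrum isDigit_zero ht, ?_⟩
      have h1 := one_mem_translations hβ
      have h2 := neg_mem_translations h1
      rcases hi with rfl | rfl | rfl
      · simpa [T] using h1
      · exact absurd rfl h0
      · simpa [T] using h2
  have : Std.Symm (Adjacent β) := ⟨fun _ _ => Adjacent.symm⟩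
  exact (key i hi).trans (Relation.ReflTransGen.stdSymm.symm _ _ (key j hj))

/-- Applying the same T_i to both points may destroy coalescence, but applying the first letters of
the two coalescing words does not. Changing a letter moves a point by steps of ±1, which lie in Δ.
-/
theorem Adjacent.chain_T (hβ : IsHyperbolic β) {y z : ℝ} (h : Adjacent β y z) {i : ℤ}
    (hi : IsDigit i) : Relation.ReflTransGen (Adjacent β) (T β i y) (T β i z) := by
  obtain ⟨hy, hz, h⟩ := h
  obtain ⟨w, hw, hr⟩ := (mem_translations_iff hz hy).1 h
  obtain ⟨c, hc, hl, hcw⟩ := (reach_iff y).1 hr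
  rw [add_sub_cancel, add_zero] at hcw
  match c, w, hc, hw, hl, hcw with
  | [], [], _, _, _, hcw =>
    rw [orbit_nil, orbit_nil] at hcw; rw [hcw]
  | j :: c, k :: w, hc, hw, hl, hcw =>
    rw [isWord_cons] at hc hw
    refine (chain_digit hβ hy hi hw.1).trans
      (Relation.ReflTransGen.trans ?_ (chain_digit hβ hz hc.1 hi))
    refine Relation.ReflTransGen.single ⟨T_mem_spectrum hw.1 hy, T_mem_spectrum hc.1 hz, ?_⟩
    exact ⟨_, T_mem_spectrum hc.1 hz, _, T_mem_spectrum hw.1 hy, rfl, c, w, hc.2, hw.2,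
      by simpa using hl, hcw⟩

/-- Induction on the code: T_i carries a chain from 0 to x into one from T_i(0) to T_i(x), and
T_i(0) is linked to 0 = T_0(0). -/
theorem spectrum_connected (hβ : IsHyperbolic β) {x : ℝ} (hx : x ∈ spectrum β) :
    Relation.ReflTransGen (Adjacent β) 0 x := by
  obtain ⟨c, hc, rfl⟩ := hx
  induction c using List.reverseRecOn with
  | nil => rw [value_nil]
  | append_singleton c i ih =>
    rw [isWord_append, isWord_cons] at hc
    rw [value_append, orbit_cons, orbit_nil]
    have h1 : Relation.ReflTransGen (Adjacent β) (T β i 0) (T β i (value β c)) := by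
      have h2 := ih hc.1
      generalize value β c = x at h2
      induction h2 with
      | refl => exact .refl
      | tail _ h ih => exact ih.trans (h.chain_T hβ hc.2.1)
    have h3 := chain_digit hβ (zero_mem_spectrum β) isDigit_zero hc.2.1
    have h4 : T β 0 0 = 0 := by simp [T]
    rw [h4] at h3
    exact h3.trans h1

end Lattice

/-! ### Pairs with equal images -/

/-- An autocorrelation is largest at 0: with m(t) the size of the fibre over t, the left side is ∑
m(t + x)m(t), and 2ab ≤ a² + b². -/
theorem card_add_fiber_le {V : Type*} [Fintype V] (h : V → ℝ) (x : ℝ) :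
    Nat.card {p : V × V // h p.1 - h p.2 = x} ≤ Nat.card {p : V × V // h p.1 - h p.2 = 0} := by
  classical
  let m : ℝ → ℕ := fun t => (Finset.univ.filter fun a => h a = t).card
  have key : ∀ y : ℝ, ∀ S : Finset ℝ, (∀ a, h a ∈ S) →
      Nat.card {p : V × V // h p.1 - h p.2 = y} = ∑ t ∈ S, m (t + y) * m t := by
    intro y S hS
    rw [Nat.card_eq_fintype_card, Fintype.card_subtype]
    rw [Finset.card_eq_sum_card_fiberwise (f := fun p : V × V => h p.2) (t := S)
      (fun p _ => hS _)]
    refine Finset.sum_congr rfl fun t _ => ?_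
    rw [← Finset.card_product]
    congr 1
    ext ⟨a, b⟩
    simp only [Finset.mem_filter, Finset.mem_univ, true_and, Finset.mem_product]
    constructor
    · rintro ⟨h1, h2⟩; exact ⟨by linarith, h2⟩
    · rintro ⟨h1, h2⟩; exact ⟨by linarith, h2⟩
  -- The union of `S₁` and `S₂` is chosen so that both it and its shift by `x` contain all values of
  -- `h`.
  let S₁ : Finset ℝ := Finset.univ.image h
  let S₂ : Finset ℝ := Finset.univ.image fun a => h a - x
  have hS : ∀ a, h a ∈ S₁ ∪ S₂ := fun a =>
    Finset.mem_union_left _ (Finset.mem_image_of_mem _ (Finset.mem_univ a))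
  have hS' : ∀ a, h a ∈ (S₁ ∪ S₂).image fun t => t + x := fun a =>
    Finset.mem_image.2 ⟨h a - x, Finset.mem_union_right _
      (Finset.mem_image.2 ⟨a, Finset.mem_univ a, rfl⟩), by ring⟩
  have e1 := key 0 _ hS
  have e2 := key 0 _ hS'
  rw [Finset.sum_image fun a _ b _ hab => add_right_cancel hab] at e2
  have e3 := key x _ hS
  simp only [add_zero] at e1 e2
  have : 2 * ∑ t ∈ S₁ ∪ S₂, m (t + x) * m t ≤
      (∑ t ∈ S₁ ∪ S₂, m (t + x) * m (t + x)) + ∑ t ∈ S₁ ∪ S₂, m t * m t := by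
    rw [← Finset.sum_add_distrib, Finset.mul_sum]
    refine Finset.sum_le_sum fun t _ => ?_
    have := two_mul_le_add_sq (m (t + x)) (m t)
    nlinarith
  omega

/-! ### The recursion for the number of representations -/

/-- The multiplicity of the digit `d` as a difference of two digits in `{0, 1}`. -/
def mult (d : ℤ) : ℝ := if d = 0 then 2 else 1

theorem mult_pos (d : ℤ) : 0 < mult d := by unfold mult; split_ifs <;> norm_num

/-- The digits as a finite set. -/
def digits : Finset ℤ := {-1, 0, 1}

theorem mem_digits {d : ℤ} : d ∈ digits ↔ IsDigit d := by simp [digits, IsDigit]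

/-- The transfer operator `g ↦ ∑_d m_d g((x - d) / β)`. -/
def transfer (β : ℝ) (g : ℝ → ℝ) (x : ℝ) : ℝ := ∑ d ∈ digits, mult d * g ((x - d) / β)

theorem transfer_eq (β : ℝ) (g : ℝ → ℝ) (x : ℝ) :
    transfer β g x = g ((x + 1) / β) + 2 * g (x / β) + g ((x - 1) / β) := by
  simp [transfer, digits, mult]
  ring

theorem count_zero (β x : ℝ) : (count β 0 x : ℝ) = if x = 0 then 1 else 0 := by
  unfold count
  split_ifs with h
  · subst h; simp
  · have : IsEmpty {p : (Fin 0 → Fin 2) × (Fin 0 → Fin 2) //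
        ∑ i : Fin 0, (((p.1 i : ℕ) : ℝ) - ((p.2 i : ℕ) : ℝ)) * β ^ (0 - 1 - (i : ℕ)) = x} :=
      ⟨fun p => h (by simpa using p.2.symm)⟩
    simp only [Nat.card_of_isEmpty, Nat.cast_zero]

theorem count_succ {β : ℝ} (hβ : β ≠ 0) (n : ℕ) (x : ℝ) :
    (count β (n + 1) x : ℝ) = transfer β (fun y => count β n y) x := by
  classical
  let F : (Fin n → Fin 2) × (Fin n → Fin 2) → ℝ := fun p =>
    ∑ i : Fin n, (((p.1 i : ℕ) : ℝ) - ((p.2 i : ℕ) : ℝ)) * β ^ (n - 1 - (i : ℕ))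
  have hF : ∀ y, count β n y = ∑ p, if F p = y then 1 else 0 := by
    intro y
    rw [count, Nat.card_eq_fintype_card, Fintype.card_subtype, Finset.card_filter]
  have hG : ∀ (a b : Fin n → Fin 2) (s t : Fin 2),
      (∑ i : Fin (n + 1), ((((Fin.snoc a s : Fin (n + 1) → Fin 2) i : ℕ) : ℝ) -
        (((Fin.snoc b t : Fin (n + 1) → Fin 2) i : ℕ) : ℝ)) * β ^ (n + 1 - 1 - (i : ℕ))) =
      β * F (a, b) + ((s : ℕ) : ℝ) - ((t : ℕ) : ℝ) := by
    intro a b s t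
    rw [Fin.sum_univ_castSucc]
    simp only [Fin.snoc_castSucc, Fin.snoc_last, Fin.val_castSucc, Fin.val_last,
      Nat.add_sub_cancel, Nat.sub_self, pow_zero, mul_one, F, Finset.mul_sum]
    rw [add_sub_assoc]
    congr 1
    refine Finset.sum_congr rfl fun i _ => ?_
    have : n - (i : ℕ) = (n - 1 - (i : ℕ)) + 1 := by have := i.2; omega
    rw [this, pow_succ]; ring
  have hc : count β (n + 1) x =
      ∑ p : (Fin n → Fin 2) × (Fin n → Fin 2), ∑ s : Fin 2, ∑ t : Fin 2,
        if β * F p + ((s : ℕ) : ℝ) - ((t : ℕ) : ℝ) = x then 1 else 0 := by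
    rw [count, Nat.card_eq_fintype_card, Fintype.card_subtype, Finset.card_filter]
    let e : (Fin 2 × (Fin n → Fin 2)) × (Fin 2 × (Fin n → Fin 2)) ≃
        (Fin (n + 1) → Fin 2) × (Fin (n + 1) → Fin 2) :=
      (Fin.snocEquiv fun _ => Fin 2).prodCongr (Fin.snocEquiv fun _ => Fin 2)
    rw [← e.sum_comp, Fintype.sum_prod_type, Fintype.sum_prod_type]
    simp only [Fintype.sum_prod_type]
    rw [Finset.sum_comm]
    refine Finset.sum_congr rfl fun a _ => ?_
    rw [Finset.sum_congr rfl fun s _ => Finset.sum_comm, Finset.sum_comm]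
    refine Finset.sum_congr rfl fun b _ => ?_
    refine Finset.sum_congr rfl fun s _ => ?_
    refine Finset.sum_congr rfl fun t _ => ?_
    have := hG a b s t
    simp only [e, Equiv.prodCongr_apply, Prod.map, Fin.snocEquiv_apply] at this ⊢
    rw [← this]
  rw [hc, transfer_eq, hF, hF, hF]
  push_cast
  rw [Finset.mul_sum, ← Finset.sum_add_distrib, ← Finset.sum_add_distrib]
  refine Finset.sum_congr rfl fun p _ => ?_
  simp only [Fin.sum_univ_two, Fin.val_zero, Fin.val_one, Nat.cast_zero, Nat.cast_one, add_zero,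
    sub_zero, eq_div_iff hβ]
  have e1 : (β * F p - 1 = x) = (F p * β = x + 1) := by
    apply propext; constructor <;> intro h <;> linarith
  have e2 : (β * F p + 1 = x) = (F p * β = x - 1) := by
    apply propext; constructor <;> intro h <;> linarith
  have e3 : (β * F p + 1 - 1 = x) = (F p * β = x) := by
    apply propext; constructor <;> intro h <;> linarith
  have e4 : (β * F p = x) = (F p * β = x) := by rw [mul_comm]
  simp only [e1, e2, e3, e4]
  ring

theorem count_le_count_zero (β : ℝ) (n : ℕ) (x : ℝ) : count β n x ≤ count β n 0 := by
  have := card_add_fiber_le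
    (fun a : Fin n → Fin 2 => ∑ i : Fin n, ((a i : ℕ) : ℝ) * β ^ (n - 1 - (i : ℕ))) x
  simpa only [count, ← Finset.sum_sub_distrib, ← sub_mul] using this

/-! ### Renewal sequences -/

theorem tendsto_convolution {γ u : ℕ → ℝ} (hγ : Summable γ) (hγ0 : ∀ k, 0 ≤ γ k)
    (hu : ∀ n, |u n| ≤ 1) {F : Filter ℕ} (hF : F ≤ atTop) {h : ℕ → ℝ}
    (hh : ∀ k, Tendsto (fun n => u (n - k)) F (𝓝 (h k))) :
    Tendsto (fun n => ∑ k ∈ Finset.range (n + 1), γ k * u (n - k)) F (𝓝 (∑' k, γ k * h k)) := by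
  have key : ∀ n, ∑ k ∈ Finset.range (n + 1), γ k * u (n - k) =
      ∑' k, if k ∈ Finset.range (n + 1) then γ k * u (n - k) else 0 := by
    intro n
    rw [tsum_eq_sum (s := Finset.range (n + 1)) fun k hk => if_neg hk]
    exact Finset.sum_congr rfl fun k hk => (if_pos hk).symm
  simp only [key]
  refine tendsto_tsum_of_dominated_convergence hγ (fun k => ?_) (Eventually.of_forall fun n k => ?_)
  · refine ((hh k).const_mul (γ k)).congr' ?_
    filter_upwards [hF (eventually_ge_atTop k)] with n hn
    rw [if_pos (Finset.mem_range.2 (by omega))]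
  · split_ifs
    · rw [Real.norm_eq_abs, abs_mul, abs_of_nonneg (hγ0 k)]
      exact mul_le_of_le_one_right (hγ0 k) (hu _)
    · simpa using hγ0 k

/-- The renewal theorem in the positive recurrent case. The lower bound on `u` forces ∑ φ = 1 and
finite mean; `0 < φ 0` gives aperiodicity. At an extreme cluster point, averaging by φ forces all
backward limits to be equal, and the conserved sum `hid` then fixes their value, so the largest and
smallest cluster points coincide. -/
theorem renewal_tendsto {u φ : ℕ → ℝ} {c : ℝ} (hc : 0 < c) (hcu : ∀ n, c ≤ u n)
    (hu1 : ∀ n, u n ≤ 1) (hφ : ∀ n, 0 ≤ φ n) (hφ0 : 0 < φ 0) (hu0 : u 0 = 1)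
    (hrec : ∀ n, u (n + 1) = ∑ k ∈ Finset.range (n + 1), φ k * u (n - k)) :
    ∃ κ, 0 < κ ∧ Tendsto u atTop (𝓝 κ) := by
  have hupos : ∀ n, 0 < u n := fun n => hc.trans_le (hcu n)
  have habs : ∀ n, |u n| ≤ 1 := fun n => by rw [abs_of_pos (hupos n)]; exact hu1 n
  let r : ℕ → ℝ := fun n => 1 - ∑ k ∈ Finset.range n, φ k
  have hr0 : r 0 = 1 := by simp [r]
  have hrs : ∀ n, r (n + 1) = r n - φ n := fun n => by simp [r, Finset.sum_range_succ]; ring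
  have hanti : Antitone r := antitone_nat_of_succ_le fun n => by rw [hrs]; linarith [hφ n]
  have hr1 : ∀ n, r n ≤ 1 := fun n => hr0 ▸ hanti (Nat.zero_le n)
  have hid : ∀ n, ∑ k ∈ Finset.range (n + 1), r k * u (n - k) = 1 := by
    intro n
    induction n with
    | zero => simp [hr0, hu0]
    | succ n ih =>
      rw [Finset.sum_range_succ']
      simp only [hr0, Nat.sub_zero, one_mul, hrs, Nat.add_sub_add_right, sub_mul,
        Finset.sum_sub_distrib, ih, hrec n]
      ring
  -- If some `r N` were negative, every later term of `hid` would be at most `r N * c` and the sum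
  -- would tend to -∞ instead of being 1.
  have hrn : ∀ n, 0 ≤ r n := by
    by_contra! hcon
    obtain ⟨N, hN⟩ := hcon
    have hb : ∀ m : ℕ, 1 ≤ (N : ℝ) + m * (r N * c) := by
      intro m
      cases m with
      | zero =>
        have : N ≠ 0 := by rintro rfl; linarith
        simpa using Nat.one_le_iff_ne_zero.2 this
      | succ m =>
        rw [← hid (N + m), add_assoc, Finset.sum_range_add]
        refine add_le_add ?_ ?_
        · refine (Finset.sum_le_card_nsmul _ _ 1 fun k _ => ?_).trans (by simp)
          exact (mul_le_mul_of_nonneg_right (hr1 k) (hupos _).le).trans (by simpa using hu1 _)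
        · refine (Finset.sum_le_card_nsmul _ _ (r N * c) fun k _ => ?_).trans (by simp)
          have h1 : r (N + k) ≤ r N := hanti (Nat.le_add_right _ _)
          exact (mul_le_mul_of_nonneg_right h1 (hupos _).le).trans
            (mul_le_mul_of_nonpos_left (hcu _) hN.le)
    obtain ⟨m, hm⟩ := exists_nat_gt ((N : ℝ) / (-(r N * c)))
    have h2 : 0 < -(r N * c) := by nlinarith
    rw [div_lt_iff₀ h2] at hm
    linarith [hb m]
  have hrsum : Summable r := by
    refine summable_of_sum_range_le (c := c⁻¹) hrn fun n => ?_
    have h1 : c * ∑ k ∈ Finset.range (n + 1), r k ≤ 1 := by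
      rw [← hid n, Finset.mul_sum]
      refine Finset.sum_le_sum fun k _ => ?_
      rw [mul_comm]
      exact mul_le_mul_of_nonneg_left (hcu _) (hrn k)
    rw [Finset.sum_range_succ] at h1
    rw [inv_eq_one_div, le_div_iff₀ hc]
    nlinarith [mul_nonneg hc.le (hrn n)]
  have hφsum : HasSum φ 1 := by
    rw [hasSum_iff_tendsto_nat_of_nonneg hφ]
    have := hrsum.tendsto_atTop_zero.const_sub 1
    simpa [r] using this
  have hlim : ∀ F : Ultrafilter ℕ, (F : Filter ℕ) ≤ atTop → ∃ h : ℕ → ℝ,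
      (∀ k, Tendsto (fun n => u (n - k)) F (𝓝 (h k))) ∧ ∀ k, MapClusterPt (h k) atTop u := by
    intro F hF
    have : ∀ k, ∃ y, Tendsto (fun n => u (n - k)) F (𝓝 y) := by
      intro k
      obtain ⟨y, -, hy⟩ := (isCompact_Icc (a := c) (b := (1 : ℝ))).ultrafilter_le_nhds
        (F.map fun n => u (n - k)) (by
          exact le_principal_iff.2 (Ultrafilter.mem_map.2
            (Filter.mem_of_superset univ_mem fun n _ => ⟨hcu _, hu1 _⟩)))
      exact ⟨y, hy⟩
    choose h hh using this
    refine ⟨h, hh, fun k => mapClusterPt_iff_ultrafilter.2 ⟨F.map fun n => n - k, ?_, hh k⟩⟩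
    exact (tendsto_sub_atTop_nat k).mono_left hF
  -- The sign `s` treats the maximum (`s = 1`) and the minimum (`s = -1`) together.
  have hext : ∀ (s x : ℝ), s ≠ 0 → MapClusterPt x atTop u →
      (∀ y, MapClusterPt y atTop u → 0 ≤ s * (x - y)) → x * ∑' k, r k = 1 := by
    intro s x hs hx hmax
    obtain ⟨F, hF, hFx⟩ := mapClusterPt_iff_ultrafilter.1 hx
    obtain ⟨h, hh, hcl⟩ := hlim F hF
    have h0 : h 0 = x := tendsto_nhds_unique (hh 0) hFx
    have hle : ∀ k, |h k| ≤ 1 := fun k =>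
      le_of_tendsto (hh k).abs (Eventually.of_forall fun n => habs _)
    have hstep : ∀ k, h k = x → h (k + 1) = x := by
      intro k hk
      have h1 : Tendsto (fun n => u (n - k)) F (𝓝 (∑' j, φ j * h (k + 1 + j))) := by
        have h2 := tendsto_convolution hφsum.summable hφ habs
          (F := (F : Filter ℕ).map fun n => n - (k + 1)) (h := fun j => h (k + 1 + j))
          ((tendsto_sub_atTop_nat (k + 1)).mono_left hF) (fun j => by
            rw [tendsto_map'_iff]
            refine (hh (k + 1 + j)).congr fun n => ?_
            simp only [Function.comp]
            rw [Nat.sub_sub])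
        rw [tendsto_map'_iff] at h2
        refine h2.congr' ?_
        filter_upwards [hF (eventually_ge_atTop (k + 1))] with n hn
        simp only [Function.comp]
        rw [← hrec]
        congr 1; omega
      have h2 : x = ∑' j, φ j * h (k + 1 + j) := hk ▸ tendsto_nhds_unique (hh k) h1
      have hsum : Summable fun j => φ j * h (k + 1 + j) := by
        refine Summable.of_norm_bounded hφsum.summable fun j => ?_
        rw [Real.norm_eq_abs, abs_mul, abs_of_nonneg (hφ j)]
        exact mul_le_of_le_one_right (hφ j) (hle _)
      have h3 : HasSum (fun j => s * (φ j * x - φ j * h (k + 1 + j))) 0 := by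
        have := ((hφsum.mul_right x).sub hsum.hasSum).mul_left s
        rwa [← h2, one_mul, sub_self, mul_zero] at this
      have h4 := (hasSum_zero_iff_of_nonneg (fun j => by
        have := mul_nonneg (hφ j) (hmax _ (hcl (k + 1 + j)))
        change 0 ≤ s * (φ j * x - φ j * h (k + 1 + j))
        linarith)).1 h3
      have h5 := congrFun h4 0
      simp only [Pi.zero_apply, ← mul_sub, mul_eq_zero, hs, hφ0.ne', false_or, add_zero] at h5
      linarith
    have hall : ∀ k, h k = x := fun k => by
      induction k with
      | zero => exact h0
      | succ k ih => exact hstep k ih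
    have h1 := tendsto_convolution hrsum hrn habs hF hh
    simp only [hid, hall] at h1
    rw [← tsum_mul_left]
    simpa [mul_comm] using (tendsto_nhds_unique h1 tendsto_const_nhds)
  let S : Set ℝ := {x | MapClusterPt x atTop u}
  have hSsub : S ⊆ Set.Icc c 1 := by
    intro x hx
    have h1 : Set.Icc c 1 ∈ map u atTop :=
      Filter.mem_map.2 (Filter.mem_of_superset univ_mem fun n _ => ⟨hcu n, hu1 n⟩)
    have h2 := (ClusterPt.mono hx (le_principal_iff.2 h1)).mem_closure
    rwa [isClosed_Icc.closure_eq] at h2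
  have hScl : IsClosed S := isClosed_setOfPred_clusterPt
  have hSc : IsCompact S := isCompact_Icc.of_isClosed_subset hScl hSsub
  have hSne : S.Nonempty := by
    obtain ⟨h, -, hcl⟩ := hlim (Ultrafilter.of atTop) (Ultrafilter.of_le _)
    exact ⟨h 0, hcl 0⟩
  obtain ⟨x, hx, hxm⟩ := hSc.exists_isGreatest hSne
  obtain ⟨y, hy, hym⟩ := hSc.exists_isLeast hSne
  have ex := hext 1 x one_ne_zero hx fun t ht => by have := hxm ht; linarith
  have ey := hext (-1) y (by norm_num) hy fun t ht => by have := hym ht; linarith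
  have hR : ∑' k, r k ≠ 0 := by intro h; rw [h, mul_zero] at ex; exact zero_ne_one ex
  have hxy : x = y := mul_right_cancel₀ hR (ex.trans ey.symm)
  refine ⟨x, hc.trans_le (hSsub hx).1, ?_⟩
  refine isCompact_Icc.tendsto_nhds_of_unique_mapClusterPt (s := Set.Icc c 1)
    (Eventually.of_forall fun n => ⟨hcu n, hu1 n⟩) fun t _ ht => ?_
  exact le_antisymm (hxm ht) (hxy ▸ hym ht)

/-- Growth rate of a sequence that is multiplicative up to a constant. -/
theorem exists_growth_rate {a : ℕ → ℝ} {M : ℝ} (h1 : ∀ n, 1 ≤ a n)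
    (hsup : ∀ n m, a n * a m ≤ a (n + m)) (hsub : ∀ n m, a (n + m) ≤ M * (a n * a m)) :
    ∃ lam : ℝ, 0 < lam ∧ ∀ n, a n ≤ lam ^ n ∧ lam ^ n ≤ M * a n := by
  have hpos : ∀ n, 0 < a n := fun n => one_pos.trans_le (h1 n)
  have ha0 : a 0 = 1 := by
    have := hsup 0 0
    nlinarith [h1 0]
  have hM : 1 ≤ M := by simpa [ha0] using hsub 0 0
  have hMpos : 0 < M := by linarith
  -- Fekete's lemma for -log a and for log(M a); both give the same growth rate, which bounds `a`
  -- from the two sides.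
  have hu : Subadditive fun n => -Real.log (a n) := by
    intro m n
    have := Real.log_le_log (mul_pos (hpos m) (hpos n)) (hsup m n)
    rw [Real.log_mul (hpos m).ne' (hpos n).ne'] at this
    linarith
  have hv : Subadditive fun n => Real.log (M * a n) := by
    intro m n
    have h2 : M * a (m + n) ≤ (M * a m) * (M * a n) := by
      have := mul_le_mul_of_nonneg_left (hsub m n) hMpos.le
      nlinarith
    have := Real.log_le_log (mul_pos hMpos (hpos _)) h2
    rwa [Real.log_mul (mul_pos hMpos (hpos m)).ne' (mul_pos hMpos (hpos n)).ne'] at this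
  have hpow : ∀ n, a n ≤ (M * a 1) ^ n := by
    intro n
    induction n with
    | zero => simp [ha0]
    | succ n ih =>
      refine (hsub n 1).trans ?_
      rw [pow_succ]
      have := mul_le_mul_of_nonneg_right ih (mul_pos hMpos (hpos 1)).le
      linarith
  have hbu : BddBelow (Set.range fun n : ℕ => -Real.log (a n) / n) := by
    refine ⟨-Real.log (M * a 1), ?_⟩
    rintro _ ⟨n, rfl⟩
    have h2 := Real.log_le_log (hpos n) (hpow n)
    rw [Real.log_pow] at h2
    have h4 : 0 ≤ Real.log (M * a 1) := Real.log_nonneg (one_le_mul_of_one_le_of_one_le hM (h1 1))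
    rcases Nat.eq_zero_or_pos n with rfl | hn
    · simpa using h4
    · have h3 : (0 : ℝ) < n := by exact_mod_cast hn
      simp only
      rw [le_div_iff₀ h3]; linarith
  have hbv : BddBelow (Set.range fun n : ℕ => Real.log (M * a n) / n) := by
    refine ⟨0, ?_⟩
    rintro _ ⟨n, rfl⟩
    exact div_nonneg (Real.log_nonneg (one_le_mul_of_one_le_of_one_le hM (h1 n))) n.cast_nonneg
  have hlim : hv.lim = -hu.lim := by
    refine tendsto_nhds_unique (hv.tendsto_lim hbv) ?_
    have h2 := (hu.tendsto_lim hbu).neg.add (tendsto_const_div_atTop_nhds_zero_nat (Real.log M))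
    rw [add_zero] at h2
    refine h2.congr fun n => ?_
    rw [Real.log_mul hMpos.ne' (hpos n).ne']
    ring
  refine ⟨Real.exp (-hu.lim), Real.exp_pos _, fun n => ?_⟩
  rw [← Real.exp_nat_mul]
  rcases Nat.eq_zero_or_pos n with rfl | hn
  · simpa [ha0] using hM
  have h3 : (0 : ℝ) < n := by exact_mod_cast hn
  have e1 := hu.lim_le_div hbu hn.ne'
  have e2 := hv.lim_le_div hbv hn.ne'
  rw [le_div_iff₀ h3] at e1 e2
  rw [hlim] at e2
  constructor
  · rw [← Real.log_le_iff_le_exp (hpos n)]; linarith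
  · rw [← Real.le_log_iff_exp_le (mul_pos hMpos (hpos n))]; linarith

variable {β : ℝ}

/-! ### Asymptotics of the number of representations -/

theorem transfer_nonneg {g : ℝ → ℝ} (hg : ∀ x, 0 ≤ g x) (x : ℝ) : 0 ≤ transfer β g x :=
  Finset.sum_nonneg fun d _ => mul_nonneg (mult_pos d).le (hg _)

theorem exists_ne_zero_of_transfer_ne_zero {g : ℝ → ℝ} {x : ℝ} (h : transfer β g x ≠ 0) :
    ∃ d, IsDigit d ∧ g ((x - d) / β) ≠ 0 := by
  obtain ⟨d, hd, h⟩ := Finset.exists_ne_zero_of_sum_ne_zero h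
  exact ⟨d, mem_digits.1 hd, right_ne_zero_of_mul h⟩

theorem exists_word_of_count_ne_zero (hβ : β ≠ 0) {n : ℕ} {x : ℝ} (h : (count β n x : ℝ) ≠ 0) :
    ∃ c, IsWord c ∧ c.length = n ∧ value β c = x := by
  induction n generalizing x with
  | zero =>
    rw [count_zero] at h
    exact ⟨[], isWord_nil, rfl, by simpa [eq_comm] using h⟩
  | succ n ih =>
    rw [count_succ hβ] at h
    obtain ⟨d, hd, h⟩ := exists_ne_zero_of_transfer_ne_zero h
    obtain ⟨c, hc, hl, hx⟩ := ih h
    refine ⟨c ++ [d], by simp [hc, hd, isWord_nil], by simp [hl], ?_⟩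
    rw [value_append, hx]
    simp [T, mul_div_cancel₀ _ hβ]

theorem one_le_count_value (hβ : β ≠ 0) {c : List ℤ} (hc : IsWord c) :
    (1 : ℝ) ≤ count β c.length (value β c) := by
  induction c using List.reverseRecOn with
  | nil => simp [count_zero]
  | append_singleton c d ih =>
    rw [isWord_append, isWord_cons] at hc
    rw [List.length_append, List.length_singleton, count_succ hβ, transfer]
    refine le_trans ?_ (Finset.single_le_sum (fun d _ => mul_nonneg (mult_pos d).le
      (Nat.cast_nonneg _)) (mem_digits.2 hc.2.1))
    have h1 : (value β (c ++ [d]) - d) / β = value β c := by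
      rw [value_append, orbit_cons, orbit_nil, T, add_sub_cancel_right, mul_div_cancel_left₀ _ hβ]
    have h2 : 1 ≤ mult d := by unfold mult; split_ifs <;> norm_num
    rw [h1]
    exact one_le_mul_of_one_le_of_one_le h2 (ih hc.1)

theorem exists_count_support (hβ : β ≠ 0) (n : ℕ) :
    ∃ S : Finset ℝ, ∀ x, (count β n x : ℝ) ≠ 0 → x ∈ S := by
  classical
  induction n with
  | zero =>
    refine ⟨{0}, fun x h => ?_⟩
    rw [count_zero] at h
    simpa using h
  | succ n ih =>
    obtain ⟨S, hS⟩ := ih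
    refine ⟨digits.biUnion fun d => S.image fun y => β * y + d, fun x h => ?_⟩
    rw [count_succ hβ] at h
    obtain ⟨d, hd, h⟩ := exists_ne_zero_of_transfer_ne_zero h
    refine Finset.mem_biUnion.2 ⟨d, mem_digits.2 hd, Finset.mem_image.2 ⟨_, hS _ h, ?_⟩⟩
    rw [mul_div_cancel₀ _ hβ, sub_add_cancel]

theorem count_add (hβ : β ≠ 0) {n : ℕ} {S : Finset ℝ} (hS : ∀ x, (count β n x : ℝ) ≠ 0 → x ∈ S)
    (m : ℕ) (x : ℝ) : (count β (n + m) x : ℝ) =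
      ∑ y ∈ S, (count β n y : ℝ) * count β m (x - β ^ m * y) := by
  classical
  induction m generalizing x with
  | zero =>
    simp only [add_zero, count_zero, pow_zero, one_mul, sub_eq_zero, mul_ite, mul_one, mul_zero,
      Finset.sum_ite_eq]
    split_ifs with h
    · rfl
    · by_contra hne; exact h (hS x hne)
  | succ m ih =>
    rw [← add_assoc, count_succ hβ, transfer]
    simp only [ih, count_succ hβ, transfer, Finset.mul_sum]
    rw [Finset.sum_comm]
    refine Finset.sum_congr rfl fun y _ => Finset.sum_congr rfl fun d _ => ?_
    have : (x - d) / β - β ^ m * y = (x - β ^ (m + 1) * y - d) / β := by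
      field_simp; ring
    rw [this]; ring

theorem count_zero_mul_le (hβ : β ≠ 0) (n m : ℕ) (x : ℝ) :
    (count β n 0 : ℝ) * count β m x ≤ count β (n + m) x := by
  classical
  obtain ⟨S, hS⟩ := exists_count_support hβ n
  rw [count_add hβ (S := insert 0 S) (fun x hx => Finset.mem_insert_of_mem (hS x hx))]
  have := Finset.single_le_sum (s := insert 0 S)
    (f := fun y => (count β n y : ℝ) * count β m (x - β ^ m * y))
    (fun y _ => by positivity) (Finset.mem_insert_self 0 S)
  simpa using this

theorem finite_translations (hβ : IsHyperbolic β) : (translations β).Finite :=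
  (finite_differences hβ).subset translations_subset

/-- Cut a representation of 0 after n digits. The intermediate value can still return to 0, so it
lies in Δ, and each factor is maximal at 0. -/
theorem count_add_le (hβ : IsHyperbolic β) (n m : ℕ) : (count β (n + m) 0 : ℝ) ≤
    (finite_translations hβ).toFinset.card * ((count β n 0 : ℝ) * count β m 0) := by
  classical
  obtain ⟨S, hS⟩ := exists_count_support hβ.pos.ne' n
  rw [count_add hβ.pos.ne' hS]
  let D := (finite_translations hβ).toFinset
  have h0 : ∀ y ∈ S, y ∉ D → (count β n y : ℝ) * count β m (0 - β ^ m * y) = 0 := by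
    intro y _ hy
    by_contra hne
    obtain ⟨h1, h2⟩ := ne_zero_and_ne_zero_of_mul hne
    obtain ⟨c, hc, -, rfl⟩ := exists_word_of_count_ne_zero hβ.pos.ne' h1
    obtain ⟨d, hd, hl, h3⟩ := exists_word_of_count_ne_zero hβ.pos.ne' h2
    apply hy
    rw [Set.Finite.mem_toFinset]
    have h4 := mem_translations_iff (value_mem_spectrum β hc) (zero_mem_spectrum β)
    rw [sub_zero] at h4
    refine h4.2 ⟨List.replicate m 0, isWord_replicate m, d, hd, by simp [hl], ?_⟩
    rw [value_replicate_zero, orbit_eq, h3, hl]; ring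
  calc _ ≤ ∑ y ∈ S, if y ∈ D then (count β n 0 : ℝ) * count β m 0 else 0 := by
        refine Finset.sum_le_sum fun y hy => ?_
        split_ifs with h
        · exact mul_le_mul (by exact_mod_cast count_le_count_zero β n y)
            (by exact_mod_cast count_le_count_zero β m _) (Nat.cast_nonneg _) (Nat.cast_nonneg _)
        · exact (h0 y hy h).le
    _ ≤ _ := by
        rw [← Finset.sum_filter, Finset.sum_const, nsmul_eq_mul]
        refine mul_le_mul_of_nonneg_right ?_ (by positivity)
        exact_mod_cast Finset.card_le_card fun y hy => (Finset.mem_filter.1 hy).2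

/-- Weighted number of representations of `x` of length `n` that do not return to `0`. -/
def taboo (β : ℝ) : ℕ → ℝ → ℝ
  | 0, x => if x = 0 then 1 else 0
  | n + 1, x => if x = 0 then 0 else transfer β (taboo β n) x

theorem taboo_nonneg (n : ℕ) (x : ℝ) : 0 ≤ taboo β n x := by
  induction n generalizing x with
  | zero => simp only [taboo]; split_ifs <;> norm_num
  | succ n ih =>
    simp only [taboo]
    split_ifs
    · exact le_rfl
    · exact transfer_nonneg ih x

theorem transfer_sum {ι : Type*} (s : Finset ι) (g : ι → ℝ → ℝ) (a : ι → ℝ) (x : ℝ) :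
    transfer β (fun y => ∑ k ∈ s, g k y * a k) x = ∑ k ∈ s, transfer β (g k) x * a k := by
  simp only [transfer, Finset.mul_sum, Finset.sum_mul]
  rw [Finset.sum_comm]
  exact Finset.sum_congr rfl fun k _ => Finset.sum_congr rfl fun d _ => by ring

/-- Decomposition by the last visit of the partial values to 0, which happens `k` steps before the
end. -/
theorem count_eq_sum_taboo (hβ : β ≠ 0) (n : ℕ) (x : ℝ) : (count β n x : ℝ) =
    ∑ k ∈ Finset.range (n + 1), taboo β k x * count β (n - k) 0 := by
  induction n generalizing x with
  | zero => simp [count_zero, taboo]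
  | succ n ih =>
    rw [Finset.sum_range_succ']
    by_cases hx : x = 0
    · simp [taboo, hx]
    · simp only [taboo, hx, if_false, Nat.add_sub_add_right, zero_mul, add_zero]
      rw [count_succ hβ, ← transfer_sum]
      simp only [ih]

theorem count_succ_zero_eq_sum (hβ : β ≠ 0) (n : ℕ) : (count β (n + 1) 0 : ℝ) =
    ∑ k ∈ Finset.range (n + 1), transfer β (taboo β k) 0 * count β (n - k) 0 := by
  rw [count_succ hβ, ← transfer_sum]
  simp only [count_eq_sum_taboo hβ n]

/-- `renewal_tendsto` gives the limit κ at 0, with excursions from 0 as renewal weights. The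
last-visit decomposition transfers it to every x, giving κ ∑ taboo_k(x) λ⁻ᵏ. Vanishing off the
spectrum and the eigenfunction equation are what the matrices need later. -/
theorem exists_limit (hβ : IsHyperbolic β) : ∃ (lam : ℝ) (μ : ℝ → ℝ), 1 < lam ∧
    (∀ x : ℝ, Tendsto (fun n : ℕ => (count β n x : ℝ) / lam ^ n) atTop (𝓝 (μ x))) ∧
    (∀ x ∈ spectrum β, 0 < μ x) ∧ (∀ x ∉ spectrum β, μ x = 0) ∧
    ∀ x, lam * μ x = transfer β μ x := by
  have hβ0 := hβ.pos.ne'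
  have h1 : ∀ n, (1 : ℝ) ≤ count β n 0 := by
    intro n
    have := one_le_count_value hβ0 (isWord_replicate n)
    rwa [value_replicate_zero, List.length_replicate] at this
  set M : ℝ := ((finite_translations hβ).toFinset.card : ℝ)
  obtain ⟨lam, hlam, hrate⟩ := exists_growth_rate (a := fun n => (count β n 0 : ℝ)) (M := M) h1
    (fun n m => count_zero_mul_le hβ0 n m 0) (count_add_le hβ)
  have hM : 0 < M := by
    have := hrate 0
    simp only [pow_zero, count_zero, if_true, mul_one] at this
    linarith
  have hlam1 : 1 < lam := by
    have h2 := (hrate 1).1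
    rw [pow_one] at h2
    refine lt_of_lt_of_le ?_ h2
    rw [count_succ hβ0, transfer_eq]
    simp only [count_zero]
    split_ifs <;> simp_all
  have hpow : ∀ n, 0 < lam ^ n := fun n => pow_pos hlam n
  let u : ℕ → ℝ := fun n => (count β n 0 : ℝ) / lam ^ n
  have hu1 : ∀ n, u n ≤ 1 := fun n => (div_le_one (hpow n)).2 (hrate n).1
  have huc : ∀ n, M⁻¹ ≤ u n := fun n => by
    rw [le_div_iff₀ (hpow n), inv_mul_le_iff₀ hM]; exact (hrate n).2
  have huabs : ∀ n, |u n| ≤ 1 := fun n => by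
    rw [abs_of_pos ((inv_pos.2 hM).trans_le (huc n))]; exact hu1 n
  obtain ⟨κ, hκ, hκu⟩ := renewal_tendsto (u := u)
    (φ := fun k => transfer β (taboo β k) 0 / lam ^ (k + 1)) (inv_pos.2 hM) huc hu1
    (fun k => div_nonneg (transfer_nonneg (taboo_nonneg k) 0) (hpow _).le)
    (by
      refine div_pos ?_ (hpow _)
      rw [transfer_eq]
      have h2 := taboo_nonneg (β := β) 0 ((0 + 1) / β)
      have h3 := taboo_nonneg (β := β) 0 ((0 - 1) / β)
      have h4 : taboo β 0 (0 / β) = 1 := by simp [taboo]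
      rw [h4]; linarith)
    (by simp [u, count_zero])
    (fun n => by
      simp only [u]
      rw [count_succ_zero_eq_sum hβ0, Finset.sum_div]
      refine Finset.sum_congr rfl fun k hk => ?_
      rw [div_mul_div_comm, ← pow_add]
      congr 2
      have := Finset.mem_range.1 hk; omega)
  have hdecomp : ∀ x n, (count β n x : ℝ) / lam ^ n =
      ∑ k ∈ Finset.range (n + 1), taboo β k x / lam ^ k * u (n - k) := by
    intro x n
    rw [count_eq_sum_taboo hβ0, Finset.sum_div]
    refine Finset.sum_congr rfl fun k hk => ?_
    simp only [u]
    rw [div_mul_div_comm, ← pow_add]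
    congr 2
    have := Finset.mem_range.1 hk; omega
  have hγ0 : ∀ x k, 0 ≤ taboo β k x / lam ^ k := fun x k =>
    div_nonneg (taboo_nonneg k x) (hpow k).le
  have hsum : ∀ x, Summable fun k => taboo β k x / lam ^ k := by
    intro x
    refine summable_of_sum_range_le (c := M) (hγ0 x) fun n => ?_
    have h2 : (count β n x : ℝ) / lam ^ n ≤ 1 :=
      (div_le_one (hpow n)).2 (le_trans (by exact_mod_cast count_le_count_zero β n x) (hrate n).1)
    have h3 : (∑ k ∈ Finset.range (n + 1), taboo β k x / lam ^ k) * M⁻¹ ≤ 1 := by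
      refine le_trans ?_ h2
      rw [hdecomp, Finset.sum_mul]
      exact Finset.sum_le_sum fun k _ => mul_le_mul_of_nonneg_left (huc _) (hγ0 x k)
    rw [Finset.sum_range_succ] at h3
    rw [← div_eq_mul_inv, div_le_one hM] at h3
    linarith [hγ0 x n]
  have hlimit : ∀ x, Tendsto (fun n : ℕ => (count β n x : ℝ) / lam ^ n) atTop
      (𝓝 (∑' k, taboo β k x / lam ^ k * κ)) := by
    intro x
    simp only [hdecomp x]
    exact tendsto_convolution (hsum x) (hγ0 x) huabs le_rfl
      fun k => hκu.comp (tendsto_sub_atTop_nat k)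
  refine ⟨lam, _, hlam1, hlimit, fun x hx => ?_, fun x hx => ?_, fun x => ?_⟩
  · obtain ⟨c, hc, rfl⟩ := hx
    have h2 := (hlimit (value β c)).comp (tendsto_add_atTop_nat c.length)
    refine lt_of_lt_of_le (div_pos hκ (hpow c.length))
      (le_of_tendsto_of_tendsto' (hκu.div_const (lam ^ c.length)) h2 fun n => ?_)
    simp only [u, Function.comp]
    rw [div_div, ← pow_add]
    refine div_le_div_of_nonneg_right ?_ (hpow _).le
    refine le_trans ?_ (count_zero_mul_le hβ0 n c.length _)
    exact le_mul_of_one_le_right (Nat.cast_nonneg _) (one_le_count_value hβ0 hc)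
  · refine tendsto_nhds_unique (hlimit x) ?_
    have : ∀ n, (count β n x : ℝ) = 0 := by
      intro n
      by_contra hne
      obtain ⟨c, hc, -, rfl⟩ := exists_word_of_count_ne_zero hβ0 hne
      exact hx ⟨c, hc, rfl⟩
    simp [this]
  · have h2 := (((hlimit x).comp (tendsto_add_atTop_nat 1)).const_mul lam)
    refine tendsto_nhds_unique h2 ?_
    have h3 : Tendsto (fun n => ∑ d ∈ digits, mult d *
        ((count β n ((x - d) / β) : ℝ) / lam ^ n)) atTop (𝓝 (∑ d ∈ digits, mult d *
          ∑' k, taboo β k ((x - d) / β) / lam ^ k * κ)) :=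
      tendsto_finsetSum _ fun d _ => (hlimit _).const_mul _
    refine h3.congr fun n => ?_
    simp only [Function.comp]
    rw [count_succ hβ0, transfer, pow_succ, ← mul_div_assoc, mul_comm lam,
      mul_div_mul_right _ _ hlam.ne', Finset.sum_div]
    exact Finset.sum_congr rfl fun d _ => by ring

/-! ### Projective distance -/

section Projective

variable {k : ℕ}

/-- The cross-multiplied form also makes sense at zero entries and is linear in each of U and V, so
it can be summed against a non-negative matrix. -/
theorem projDistLE_iff {U V : Fin k → ℝ} (hU : ∀ i, 0 ≤ U i) (hV : ∀ i, 0 ≤ V i) {c : ℝ} :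
    ProjDistLE U V c ↔ (∀ i, U i = 0 ↔ V i = 0) ∧
      ∀ i j, U i * V j ≤ Real.exp c * (U j * V i) := by
  unfold ProjDistLE
  refine and_congr_right fun hz => ⟨fun h i j => ?_, fun h i j hi hj => ?_⟩
  · by_cases hi : U i = 0
    · simp [hi, (hz i).1 hi]
    by_cases hj : U j = 0
    · simp [hj, (hz j).1 hj]
    have hi' := mt (hz i).2 hi
    have hj' := mt (hz j).2 hj
    have pi := (hU i).lt_of_ne' hi
    have pj := (hU j).lt_of_ne' hj
    have qi := (hV i).lt_of_ne' hi'
    have qj := (hV j).lt_of_ne' hj'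
    have h1 := (le_abs_self _).trans (h i j hi hj)
    rw [← Real.log_div (div_pos pi qi).ne' (div_pos pj qj).ne',
      Real.log_le_iff_le_exp (div_pos (div_pos pi qi) (div_pos pj qj)), div_div_div_eq,
      div_le_iff₀ (mul_pos qi pj)] at h1
    linarith
  · have key : ∀ i j, U i ≠ 0 → U j ≠ 0 →
        Real.log (U i / V i) - Real.log (U j / V j) ≤ c := by
      intro i j hi hj
      have hi' := mt (hz i).2 hi
      have hj' := mt (hz j).2 hj
      have pi := (hU i).lt_of_ne' hi
      have pj := (hU j).lt_of_ne' hj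
      have qi := (hV i).lt_of_ne' hi'
      have qj := (hV j).lt_of_ne' hj'
      rw [← Real.log_div (div_pos pi qi).ne' (div_pos pj qj).ne',
        Real.log_le_iff_le_exp (div_pos (div_pos pi qi) (div_pos pj qj)), div_div_div_eq,
        div_le_iff₀ (mul_pos qi pj)]
      linarith [h i j]
    exact abs_sub_le_iff.2 ⟨key i j hi hj, key j i hj hi⟩

theorem ProjDistLE.smul {U V : Fin k → ℝ} {c a b : ℝ} (ha : a ≠ 0) (hb : b ≠ 0)
    (h : ProjDistLE U V c) : ProjDistLE (a • U) (b • V) c := by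
  refine ⟨fun i => by simp [ha, hb, h.1 i], fun i j hi hj => ?_⟩
  have hi' : U i ≠ 0 := fun h0 => hi (by simp [h0])
  have hj' : U j ≠ 0 := fun h0 => hj (by simp [h0])
  have key : ∀ i, U i ≠ 0 → Real.log ((a • U) i / (b • V) i) =
      Real.log (a / b) + Real.log (U i / V i) := by
    intro i hi
    rw [Pi.smul_apply, Pi.smul_apply, smul_eq_mul, smul_eq_mul, mul_div_mul_comm,
      Real.log_mul (div_ne_zero ha hb) (div_ne_zero hi (mt (h.1 i).2 hi))]
  rw [key i hi', key j hj', add_sub_add_left_eq_sub]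
  exact h.2 i j hi' hj'

theorem vecMul_nonneg {U : Fin k → ℝ} {A : Matrix (Fin k) (Fin k) ℝ} (hA : ∀ i j, 0 ≤ A i j)
    (hU : ∀ i, 0 ≤ U i) (i : Fin k) : 0 ≤ Matrix.vecMul U A i := by
  change 0 ≤ ∑ j, U j * A j i
  exact Finset.sum_nonneg fun j _ => mul_nonneg (hU j) (hA j i)

theorem vecMul_eq_zero_iff {U : Fin k → ℝ} {A : Matrix (Fin k) (Fin k) ℝ}
    (hA : ∀ i j, 0 ≤ A i j) (hU : ∀ i, 0 ≤ U i) (i : Fin k) :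
    Matrix.vecMul U A i = 0 ↔ ∀ j, U j = 0 ∨ A j i = 0 := by
  have : Matrix.vecMul U A i = ∑ j, U j * A j i := rfl
  rw [this, Finset.sum_eq_zero_iff_of_nonneg fun j _ => mul_nonneg (hU j) (hA j i)]
  simp

theorem ProjDistLE.vecMul {U V : Fin k → ℝ} {A : Matrix (Fin k) (Fin k) ℝ}
    (hA : ∀ i j, 0 ≤ A i j) (hU : ∀ i, 0 ≤ U i) (hV : ∀ i, 0 ≤ V i) {c : ℝ}
    (h : ProjDistLE U V c) : ProjDistLE (Matrix.vecMul U A) (Matrix.vecMul V A) c := by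
  rw [projDistLE_iff hU hV] at h
  rw [projDistLE_iff (vecMul_nonneg hA hU) (vecMul_nonneg hA hV)]
  refine ⟨fun i => by simp only [vecMul_eq_zero_iff hA hU, vecMul_eq_zero_iff hA hV, h.1],
    fun i j => ?_⟩
  change (∑ m, U m * A m i) * (∑ n, V n * A n j) ≤
    Real.exp c * ((∑ n, U n * A n j) * (∑ m, V m * A m i))
  rw [mul_comm (∑ n, U n * A n j), Finset.sum_mul_sum, Finset.sum_mul_sum, Finset.mul_sum]
  refine Finset.sum_le_sum fun m _ => ?_
  rw [Finset.mul_sum]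
  refine Finset.sum_le_sum fun n _ => ?_
  have := mul_le_mul_of_nonneg_right (h.2 m n) (mul_nonneg (hA m i) (hA n j))
  linarith

theorem IsAdmissible.vecMul {U : Fin (k + 1) → ℝ} {A : Matrix (Fin (k + 1)) (Fin (k + 1)) ℝ}
    (hA : ∀ i j, 0 ≤ A i j) (hA0 : A 0 0 ≠ 0) (hU : IsAdmissible U) :
    IsAdmissible (Matrix.vecMul U A) := by
  refine ⟨vecMul_nonneg hA hU.1, (vecMul_nonneg hA hU.1 0).lt_of_ne' ?_⟩
  rw [Ne, vecMul_eq_zero_iff hA hU.1]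
  exact fun h => (h 0).elim hU.2.ne' hA0

/-- A nonnegative matrix that vanishes exactly on some rows and columns not containing the index
`0` contracts the projective distance. -/
theorem exists_contraction {A : Matrix (Fin (k + 1)) (Fin (k + 1)) ℝ} (hA : ∀ i j, 0 ≤ A i j)
    {I J : Set (Fin (k + 1))} (hI : 0 ∉ I) (hIJ : ∀ i j, A i j = 0 ↔ i ∈ I ∨ j ∈ J) :
    ∃ C₁ C₂ : ℝ, 0 < C₁ ∧ 0 < C₂ ∧ C₂ < 1 ∧ ∀ U V : Fin (k + 1) → ℝ, IsAdmissible U →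
      IsAdmissible V → ProjDistLE (Matrix.vecMul U A) (Matrix.vecMul V A) C₁ ∧
        ∀ c : ℝ, ProjDistLE U V c →
          ProjDistLE (Matrix.vecMul U A) (Matrix.vecMul V A) (C₂ * c) := by
  obtain ⟨K, hK1, hK⟩ : ∃ K : ℝ, 1 < K ∧ ∀ m i j, j ∉ J → A m i ≤ K * A m j := by
    have hq : ∀ m i j, 0 ≤ A m i / A m j := fun m i j => div_nonneg (hA _ _) (hA _ _)
    refine ⟨2 + ∑ m, ∑ i, ∑ j, A m i / A m j, ?_, fun m i j hj => ?_⟩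
    · have : 0 ≤ ∑ m, ∑ i, ∑ j, A m i / A m j :=
        Finset.sum_nonneg fun m _ => Finset.sum_nonneg fun i _ => Finset.sum_nonneg fun j _ =>
          hq m i j
      linarith
    · by_cases hm : m ∈ I
      · rw [(hIJ m i).2 (Or.inl hm), (hIJ m j).2 (Or.inl hm), mul_zero]
      · have hpos : 0 < A m j := (hA m j).lt_of_ne' fun h => ((hIJ m j).1 h).elim hm hj
        rw [← div_le_iff₀ hpos]
        have h1 : A m i / A m j ≤ ∑ j, A m i / A m j :=
          Finset.single_le_sum (f := fun j => A m i / A m j) (fun j _ => hq m i j)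
            (Finset.mem_univ j)
        have h2 : ∑ j, A m i / A m j ≤ ∑ i, ∑ j, A m i / A m j :=
          Finset.single_le_sum (f := fun i => ∑ j, A m i / A m j)
            (fun i _ => Finset.sum_nonneg fun j _ => hq m i j) (Finset.mem_univ i)
        have h3 : ∑ i, ∑ j, A m i / A m j ≤ ∑ m, ∑ i, ∑ j, A m i / A m j :=
          Finset.single_le_sum (f := fun m => ∑ i, ∑ j, A m i / A m j)
            (fun m _ => Finset.sum_nonneg fun i _ => Finset.sum_nonneg fun j _ => hq m i j)
            (Finset.mem_univ m)
        linarith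
  have hK0 : 0 < K := by linarith
  have hK2 : 1 < K ^ 2 := one_lt_pow₀ hK1 two_ne_zero
  have hzero : ∀ U : Fin (k + 1) → ℝ, IsAdmissible U → ∀ i,
      Matrix.vecMul U A i = 0 ↔ i ∈ J := by
    intro U hU i
    rw [vecMul_eq_zero_iff hA hU.1]
    constructor
    · intro h
      exact ((hIJ 0 i).1 ((h 0).resolve_left hU.2.ne')).resolve_left hI
    · exact fun h j => Or.inr ((hIJ j i).2 (Or.inr h))
  have hcomp : ∀ U : Fin (k + 1) → ℝ, (∀ i, 0 ≤ U i) → ∀ i j, j ∉ J →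
      Matrix.vecMul U A i ≤ K * Matrix.vecMul U A j := by
    intro U hU i j hj
    change ∑ m, U m * A m i ≤ K * ∑ m, U m * A m j
    rw [Finset.mul_sum]
    refine Finset.sum_le_sum fun m _ => ?_
    have := mul_le_mul_of_nonneg_left (hK m i j hj) (hU m)
    linarith
  -- `K` compares two entries of the image of one vector, so ratios of two image vectors vary by at
  -- most K². Its inverse is the proportion gained in the contraction below.
  set ε : ℝ := (K ^ 2)⁻¹ with hε
  have hε0 : 0 < ε := by positivity
  have hε1 : ε < 1 := inv_lt_one_of_one_lt₀ hK2
  refine ⟨Real.log (K ^ 2), 1 - ε, Real.log_pos hK2, by linarith, by linarith,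
    fun U V hU hV => ?_⟩
  have hsame : ∀ i, Matrix.vecMul U A i = 0 ↔ Matrix.vecMul V A i = 0 := fun i => by
    rw [hzero U hU, hzero V hV]
  have hE := vecMul_nonneg hA hU.1
  have hF := vecMul_nonneg hA hV.1
  have hvan : ∀ i j, i ∈ J ∨ j ∈ J → ∀ c, Matrix.vecMul U A i * Matrix.vecMul V A j ≤
      Real.exp c * (Matrix.vecMul U A j * Matrix.vecMul V A i) := by
    rintro i j (h | h) c
    · rw [(hzero U hU i).2 h, (hzero V hV i).2 h]; simp
    · rw [(hzero U hU j).2 h, (hzero V hV j).2 h]; simp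
  refine ⟨(projDistLE_iff hE hF).2 ⟨hsame, fun i j => ?_⟩,
    fun c hc => (projDistLE_iff hE hF).2 ⟨hsame, fun i j => ?_⟩⟩
  · by_cases hi : i ∈ J
    · exact hvan i j (Or.inl hi) _
    by_cases hj : j ∈ J
    · exact hvan i j (Or.inr hj) _
    rw [Real.exp_log (by positivity)]
    have h1 := mul_le_mul (hcomp U hU.1 i j hj) (hcomp V hV.1 j i hi) (hF j)
      (mul_nonneg hK0.le (hE j))
    linarith
  · by_cases hi : i ∈ J
    · exact hvan i j (Or.inl hi) _
    by_cases hj : j ∈ J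
    · exact hvan i j (Or.inr hj) _
    have hc0 : 0 ≤ c := (abs_nonneg _).trans (hc.2 0 0 hU.2.ne' hU.2.ne')
    have hc' := ((projDistLE_iff hU.1 hV.1).1 hc).2
    have hFi : 0 < Matrix.vecMul V A i := (hF i).lt_of_ne' fun h => hi ((hzero V hV i).1 h)
    set Ei := Matrix.vecMul U A i with hEi
    set Ej := Matrix.vecMul U A j with hEj
    set Fi := Matrix.vecMul V A i with hFi'
    set Fj := Matrix.vecMul V A j with hFj'
    set s : ℝ := Ei / Fi with hs
    have hs0 : 0 ≤ s := div_nonneg (hE i) hFi.le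
    have hsE : s * Fi = Ei := div_mul_cancel₀ _ hFi.ne'
    -- `s` is a weighted mean of the ratios U_n / V_n, so each of them is at least e^{-c}s. The
    -- comparison by `K` applied to this non-negative remainder improves that lower bound after
    -- multiplication by A.
    have hlow : ∀ n, 0 ≤ U n - Real.exp (-c) * s * V n := by
      intro n
      have h1 : Ei * V n ≤ Real.exp c * (U n * Fi) := by
        change (∑ m, U m * A m i) * V n ≤ Real.exp c * (U n * ∑ m, V m * A m i)
        rw [Finset.sum_mul, Finset.mul_sum, Finset.mul_sum]
        refine Finset.sum_le_sum fun m _ => ?_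
        have := mul_le_mul_of_nonneg_right (hc' m n) (hA m i)
        linarith
      rw [← hsE] at h1
      have h2 : s * V n ≤ Real.exp c * U n := by
        refine le_of_mul_le_mul_right ?_ hFi
        linarith
      have h3 := mul_le_mul_of_nonneg_left h2 (Real.exp_pos (-c)).le
      rw [← mul_assoc, ← mul_assoc, ← Real.exp_add, neg_add_cancel, Real.exp_zero, one_mul] at h3
      linarith
    have hlin : ∀ l, Matrix.vecMul (fun n => U n - Real.exp (-c) * s * V n) A l =
        Matrix.vecMul U A l - Real.exp (-c) * s * Matrix.vecMul V A l := by
      intro l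
      change ∑ n, (U n - Real.exp (-c) * s * V n) * A n l =
        ∑ n, U n * A n l - Real.exp (-c) * s * ∑ n, V n * A n l
      rw [Finset.mul_sum, ← Finset.sum_sub_distrib]
      exact Finset.sum_congr rfl fun n _ => by ring
    have h1 := hcomp _ hlow i j hj
    rw [hlin, hlin, ← hEi, ← hEj, ← hFi', ← hFj', ← hsE] at h1
    have h2 : Fj ≤ K * Fi := hcomp V hV.1 j i hi
    have hexp1 : Real.exp (-c) ≤ 1 := Real.exp_le_one_iff.2 (by linarith)
    have h3 : ε * ((1 - Real.exp (-c)) * s * Fj) ≤ Ej - Real.exp (-c) * s * Fj := by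
      rw [hε, inv_mul_le_iff₀ (by positivity)]
      have h4 := mul_le_mul_of_nonneg_left h2 (mul_nonneg (sub_nonneg.2 hexp1) hs0)
      have h5 := mul_le_mul_of_nonneg_left h1 hK0.le
      linarith
    -- Convexity of exp turns the improved bound into the contraction factor 1 - ε.
    have hconv : Real.exp (-((1 - ε) * c)) ≤ ε + (1 - ε) * Real.exp (-c) := by
      have := convexOn_exp.2 (Set.mem_univ 0) (Set.mem_univ (-c)) hε0.le
        (by linarith : 0 ≤ 1 - ε) (by ring)
      simp only [smul_eq_mul, mul_zero, zero_add, Real.exp_zero, mul_one] at this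
      rwa [mul_neg] at this
    have h6 : Real.exp (-((1 - ε) * c)) * (s * Fj) ≤ Ej := by
      have := mul_le_mul_of_nonneg_right hconv (mul_nonneg hs0 (hF j))
      linarith
    have h7 := mul_le_mul_of_nonneg_left h6 (Real.exp_pos ((1 - ε) * c)).le
    rw [← mul_assoc, ← Real.exp_add, add_neg_cancel, Real.exp_zero, one_mul] at h7
    have h8 := mul_le_mul_of_nonneg_right h7 hFi.le
    calc Ei * Fj = s * Fj * Fi := by rw [← hsE]; ring
      _ ≤ _ := h8.trans_eq (by ring)

end Projective

/-! ### Transition matrices and coalescing differences -/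

section Transition

variable {k : ℕ}

theorem transition_eq_sum (v : Fin k → ℝ) (i : ℤ) (m n : Fin k) :
    transition β v i m n =
      ∑ d ∈ digits, if T β (d - i) (v m) = v n then mult d else 0 := by
  have inj : ∀ a b : ℤ, T β a (v m) = v n → T β b (v m) = v n → a = b := by
    intro a b ha hb
    have : (a : ℝ) = b := by
      simp only [T] at ha hb; linarith
    exact_mod_cast this
  have hd : ∀ g : ℤ → ℝ, ∑ d ∈ digits, g d = g (-1) + (g 0 + g 1) := by
    intro g; simp [digits]
  rw [hd, zero_sub]
  unfold transition
  have i1 := inj (-i) (1 - i)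
  have i2 := inj (-i) (-1 - i)
  have i3 := inj (1 - i) (-1 - i)
  by_cases h0 : T β (-i) (v m) = v n <;> by_cases h1 : T β (1 - i) (v m) = v n <;>
    by_cases h2 : T β (-1 - i) (v m) = v n
  · exact absurd (i1 h0 h1) (by omega)
  · exact absurd (i1 h0 h1) (by omega)
  · exact absurd (i2 h0 h2) (by omega)
  · simp [h0, h1, h2, mult]
  · exact absurd (i3 h1 h2) (by omega)
  · simp [h0, h1, h2, mult]
  · simp [h0, h1, h2, mult]
  · simp [h0, h1, h2]

theorem transition_nonneg (v : Fin k → ℝ) (i : ℤ) (m n : Fin k) : 0 ≤ transition β v i m n := by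
  rw [transition_eq_sum]
  exact Finset.sum_nonneg fun d _ => by split_ifs <;> [exact (mult_pos d).le; exact le_rfl]

theorem transition_ne_zero_iff (v : Fin k → ℝ) (i : ℤ) (m n : Fin k) :
    transition β v i m n ≠ 0 ↔ Reach β [i] (v m) (v n) := by
  rw [transition_eq_sum, reach_singleton, Ne, Finset.sum_eq_zero_iff_of_nonneg fun d _ => by
    split_ifs <;> [exact (mult_pos d).le; exact le_rfl]]
  push Not
  simp only [mem_digits]
  refine exists_congr fun d => and_congr_right fun _ => ?_
  split_ifs with h
  · simp [h, (mult_pos d).ne']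
  · simp [h]

theorem transitionWord_cons (v : Fin k → ℝ) (i : ℤ) (w : List ℤ) :
    transitionWord β v (i :: w) = transition β v i * transitionWord β v w := by
  simp [transitionWord]

theorem transitionWord_append (v : Fin k → ℝ) (u w : List ℤ) :
    transitionWord β v (u ++ w) = transitionWord β v u * transitionWord β v w := by
  simp [transitionWord]

theorem transitionWord_nonneg (v : Fin k → ℝ) (w : List ℤ) (m n : Fin k) :
    0 ≤ transitionWord β v w m n := by
  induction w generalizing m with
  | nil =>
    simp only [transitionWord, List.map_nil, List.prod_nil, Matrix.one_apply]
    split_ifs <;> norm_num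
  | cons i w ih =>
    rw [transitionWord_cons, Matrix.mul_apply]
    exact Finset.sum_nonneg fun p _ => mul_nonneg (transition_nonneg v i m p) (ih p)

theorem exists_reach_zero {t : ℝ} (ht : t ∈ translations β) :
    ∃ w, IsWord w ∧ Reach β w t 0 := by
  obtain ⟨x, hx, y, hy, rfl, h⟩ := ht
  exact (mem_translations_iff hx hy).1 ⟨x, hx, y, hy, rfl, h⟩

/-- Entries are non-negative, so nothing cancels. Intermediate differences on the way between
elements of Δ can be continued to 0, hence lie in Δ and are seen by the matrices. -/
theorem transitionWord_ne_zero_iff {v : Fin k → ℝ} (hinj : Function.Injective v)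
    (hran : Set.range v = translations β) {w : List ℤ} (hw : IsWord w) (m n : Fin k) :
    transitionWord β v w m n ≠ 0 ↔ Reach β w (v m) (v n) := by
  induction w generalizing m with
  | nil =>
    rw [reach_nil, hinj.eq_iff, eq_comm]
    simp [transitionWord, Matrix.one_apply]
  | cons i w ih =>
    rw [isWord_cons] at hw
    rw [transitionWord_cons, Matrix.mul_apply, Ne, Finset.sum_eq_zero_iff_of_nonneg fun p _ =>
      mul_nonneg (transition_nonneg v i m p) (transitionWord_nonneg v w p n)]
    push Not
    simp only [mul_ne_zero_iff, transition_ne_zero_iff, ih hw.2, Finset.mem_univ, true_and]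
    change _ ↔ Reach β ([i] ++ w) _ _
    rw [reach_append]
    constructor
    · rintro ⟨p, h⟩; exact ⟨v p, h⟩
    · rintro ⟨t, h1, h2⟩
      have hm : v m ∈ translations β := hran ▸ ⟨m, rfl⟩
      have hn : v n ∈ translations β := hran ▸ ⟨n, rfl⟩
      obtain ⟨z, hz, hz2⟩ := exists_reach_zero hn
      have ht : t ∈ translations β := translations_of_reach hm
        (by simp [hw.1, isWord_nil]) h1 (isWord_append.2 ⟨hw.2, hz⟩) (reach_append.2 ⟨_, h2, hz2⟩)
      rw [← hran] at ht
      obtain ⟨p, rfl⟩ := ht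
      exact ⟨p, h1, h2⟩

end Transition

/-! ### Synchronizing words -/

/-- Along `w`, every difference which survives can be moved to `0`. -/
def RowGood (β : ℝ) (w : List ℤ) : Prop :=
  ∀ u ∈ differences β, ∀ u', Reach β w u u' → (∃ t, IsWord t ∧ Reach β t u' 0) → Reach β w u 0

/-- Along `w`, every translation which is reached can be reached from `0`. -/
def ColGood (β : ℝ) (w : List ℤ) : Prop :=
  ∀ u' ∈ translations β, ∀ u ∈ translations β, Reach β w u u' → Reach β w 0 u'

theorem RowGood.append_left {w v : List ℤ} (h : RowGood β w) (hw : IsWord w) (hv : IsWord v) :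
    RowGood β (v ++ w) := by
  rintro u hu u' hr ⟨z, hz, hz2⟩
  obtain ⟨t, h1, h2⟩ := reach_append.1 hr
  have ht := differences_of_reach hu hv h1 (isWord_append.2 ⟨hw, hz⟩) (reach_append.2 ⟨_, h2, hz2⟩)
  exact reach_append.2 ⟨t, h1, h t ht u' h2 ⟨z, hz, hz2⟩⟩

theorem RowGood.append_right {w v : List ℤ} (h : RowGood β w) (hv : IsWord v) :
    RowGood β (w ++ v) := by
  rintro u hu u' hr ⟨z, hz, hz2⟩
  obtain ⟨t, h1, h2⟩ := reach_append.1 hr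
  exact reach_append.2 ⟨0, h u hu t h1 ⟨_, isWord_append.2 ⟨hv, hz⟩, reach_append.2 ⟨_, h2, hz2⟩⟩,
    reach_zero_zero β hv⟩

theorem ColGood.append_left {w v : List ℤ} (h : ColGood β w) (hw : IsWord w) (hv : IsWord v) :
    ColGood β (v ++ w) := by
  intro u' hu' u hu hr
  obtain ⟨z, hz, hz2⟩ := exists_reach_zero hu'
  obtain ⟨t, h1, h2⟩ := reach_append.1 hr
  have ht := translations_of_reach hu hv h1 (isWord_append.2 ⟨hw, hz⟩) (reach_append.2 ⟨_, h2, hz2⟩)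
  exact reach_append.2 ⟨0, reach_zero_zero β hv, h u' hu' t ht h2⟩

theorem ColGood.append_right {w v : List ℤ} (h : ColGood β w) (hw : IsWord w) (hv : IsWord v) :
    ColGood β (w ++ v) := by
  intro u' hu' u hu hr
  obtain ⟨z, hz, hz2⟩ := exists_reach_zero hu'
  obtain ⟨t, h1, h2⟩ := reach_append.1 hr
  have ht := translations_of_reach hu hw h1 (isWord_append.2 ⟨hv, hz⟩) (reach_append.2 ⟨_, h2, hz2⟩)
  exact reach_append.2 ⟨t, h t ht u hu h1, h2⟩

/-- Treat the finitely many differences one at a time, appending a word that brings the next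
survivor to 0. Those already brought to 0 can stay there. -/
theorem exists_rowGood (hβ : IsHyperbolic β) : ∃ w, IsWord w ∧ RowGood β w := by
  have key : ∀ S : Set ℝ, S.Finite → ∃ w, IsWord w ∧ ∀ u ∈ S, ∀ u', Reach β w u u' →
      (∃ t, IsWord t ∧ Reach β t u' 0) → Reach β w u 0 := by
    intro S hS
    induction S, hS using Set.Finite.induction_on with
    | empty => exact ⟨[], isWord_nil, by simp⟩
    | @insert a S _ _ ih =>
      obtain ⟨w, hw, ih⟩ := ih
      by_cases h : ∃ u', Reach β w a u' ∧ ∃ t, IsWord t ∧ Reach β t u' 0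
      · obtain ⟨u₀, h1, z, hz, h2⟩ := h
        refine ⟨w ++ z, isWord_append.2 ⟨hw, hz⟩, ?_⟩
        rintro u (rfl | hu) u' hr ⟨y, hy, hy2⟩
        · exact reach_append.2 ⟨u₀, h1, h2⟩
        · obtain ⟨t, h3, h4⟩ := reach_append.1 hr
          exact reach_append.2 ⟨0, ih u hu t h3 ⟨_, isWord_append.2 ⟨hz, hy⟩,
            reach_append.2 ⟨_, h4, hy2⟩⟩, reach_zero_zero β hz⟩
      · refine ⟨w, hw, ?_⟩
        rintro u (rfl | hu) u' hr hz
        · exact absurd ⟨u', hr, hz⟩ h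
        · exact ih u hu u' hr hz
  exact key _ (finite_differences hβ)

theorem exists_reach_of_mem_translations {t : ℝ} (ht : t ∈ translations β) :
    ∃ w, IsWord w ∧ Reach β w 0 t := by
  obtain ⟨_, ⟨c, hc, rfl⟩, _, ⟨d, hd, rfl⟩, rfl, -⟩ := ht
  refine ⟨List.replicate c.length 0 ++ d, isWord_append.2 ⟨isWord_replicate _, hd⟩,
    List.replicate d.length 0 ++ c, isWord_append.2 ⟨isWord_replicate _, hc⟩, ?_, ?_⟩
  · simp [add_comm]
  · rw [← value_eq_orbit, value_zero_append, value_zero_append, sub_add_cancel]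

/-- The mirror image of `exists_rowGood`: words are prepended, leading from 0 to some source of the
next target. -/
theorem exists_colGood (hβ : IsHyperbolic β) : ∃ w, IsWord w ∧ ColGood β w := by
  have key : ∀ S : Set ℝ, S.Finite → S ⊆ translations β → ∃ w, IsWord w ∧
      ∀ u' ∈ S, ∀ u ∈ translations β, Reach β w u u' → Reach β w 0 u' := by
    intro S hS
    induction S, hS using Set.Finite.induction_on with
    | empty => exact fun _ => ⟨[], isWord_nil, by simp⟩
    | @insert a S _ _ ih =>
      intro hsub
      obtain ⟨w, hw, ih⟩ := ih ((Set.subset_insert _ _).trans hsub)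
      by_cases h : ∃ u ∈ translations β, Reach β w u a
      · obtain ⟨u₀, hu₀, h1⟩ := h
        obtain ⟨z, hz, h2⟩ := exists_reach_of_mem_translations hu₀
        refine ⟨z ++ w, isWord_append.2 ⟨hz, hw⟩, ?_⟩
        rintro u' (rfl | hu') u hu hr
        · exact reach_append.2 ⟨u₀, h2, h1⟩
        · obtain ⟨t, h3, h4⟩ := reach_append.1 hr
          obtain ⟨y, hy, hy2⟩ := exists_reach_zero (hsub (Or.inr hu'))
          have ht := translations_of_reach hu hz h3 (isWord_append.2 ⟨hw, hy⟩)
            (reach_append.2 ⟨_, h4, hy2⟩)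
          exact reach_append.2 ⟨0, reach_zero_zero β hz, ih u' hu' t ht h4⟩
      · refine ⟨w, hw, ?_⟩
        rintro u' (rfl | hu') u hu hr
        · exact absurd ⟨u, hu, hr⟩ h
        · exact ih u' hu' u hu hr
  exact key _ (finite_translations hβ) subset_rfl

/-- Any path along `u ++ w` can be rerouted through 0 at the junction, so its existence splits into
a condition on the row and one on the column. -/
theorem isMixing_append {k : ℕ} {v : Fin (k + 1) → ℝ} (hinj : Function.Injective v)
    (hran : Set.range v = translations β) (hv0 : v 0 = 0) {u w : List ℤ} (hu : IsWord u)
    (hw : IsWord w) (hrow : RowGood β u) (hcol : ColGood β w) : IsMixing β v (u ++ w) := by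
  refine ⟨{m | ¬ Reach β u (v m) 0}, {n | ¬ Reach β w 0 (v n)}, ?_, ?_, fun i j => ?_⟩
  · simpa [hv0] using reach_zero_zero β hu
  · simpa [hv0] using reach_zero_zero β hw
  rw [← not_iff_not]
  have := transitionWord_ne_zero_iff hinj hran (isWord_append.2 ⟨hu, hw⟩) i j
  rw [Ne] at this
  rw [this, reach_append]
  simp only [Set.mem_ofPred_eq, not_or, not_not]
  constructor
  · rintro ⟨t, h1, h2⟩
    have hi : v i ∈ translations β := hran ▸ ⟨i, rfl⟩
    have hj : v j ∈ translations β := hran ▸ ⟨j, rfl⟩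
    obtain ⟨z, hz, hz2⟩ := exists_reach_zero hj
    have hz3 := reach_append.2 ⟨_, h2, hz2⟩
    have ht := translations_of_reach hi hu h1 (isWord_append.2 ⟨hw, hz⟩) hz3
    exact ⟨hrow _ (translations_subset hi) t h1 ⟨_, isWord_append.2 ⟨hw, hz⟩, hz3⟩,
      hcol _ hj t ht h2⟩
  · rintro ⟨h1, h2⟩; exact ⟨0, h1, h2⟩

/-! ### The interior of the attractor -/

theorem zero_mem_interior_attractor (hβ : IsHyperbolic β) (h : CutProjectCondition β) :
    (0 : ContractingSpace β) ∈ interior (attractor β) := by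
  have h1 : (0 : FullSpace β) ∈ liftedSpectrum β ∩ closure (box β 1) := by
    refine ⟨⟨[], isWord_nil, by simp⟩, subset_closure fun z => ?_⟩
    have : 0 < |‖(z : ℂ)‖ - 1| := abs_pos.2 (sub_ne_zero.2 (hβ.norm_ne_one _ z.2.1))
    simpa using this
  rw [h] at h1
  exact h1.1.2

/-- The cylinders of 0ᴺ shrink to 0 because the attractor is bounded. -/
theorem exists_zero_cylinder_subset (h0 : (0 : ContractingSpace β) ∈ interior (attractor β)) :
    ∃ N : ℕ, ∀ r ∈ attractor β, conjC β ^ N * r ∈ interior (attractor β) := by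
  have h1 : interior (attractor β) ∈ 𝓝 (0 : ContractingSpace β) := isOpen_interior.mem_nhds h0
  rw [nhds_pi, Filter.mem_pi] at h1
  obtain ⟨I, hI, t, ht, hsub⟩ := h1
  have h2 : ∀ z ∈ I, ∀ᶠ N : ℕ in atTop, ∀ r ∈ attractor β, (conjC β ^ N * r) z ∈ t z := by
    intro z _
    obtain ⟨ε, hε, hball⟩ := Metric.mem_nhds_iff.1 (ht z)
    have h3 : Tendsto (fun N : ℕ => ‖(z.1 : ℂ)‖ ^ N * (1 - ‖(z.1 : ℂ)‖)⁻¹) atTop (𝓝 0) := by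
      simpa using (tendsto_pow_atTop_nhds_zero_of_lt_one (norm_nonneg _) z.2).mul_const
        (1 - ‖(z.1 : ℂ)‖)⁻¹
    filter_upwards [h3.eventually (gt_mem_nhds hε)] with N hN r hr
    refine hball ?_
    rw [Metric.mem_ball, Pi.zero_apply, dist_zero_right]
    refine lt_of_le_of_lt ?_ hN
    have h4 : ‖(conjC β ^ N * r) z‖ = ‖(z.1 : ℂ)‖ ^ N * ‖(r z : ℂ)‖ := by
      change ‖coord β z (conjC β ^ N * r)‖ = _
      rw [map_mul, map_pow, norm_mul, norm_pow, coord_conjC, coord_apply]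
    rw [h4]
    exact mul_le_mul_of_nonneg_left (norm_apply_le_of_mem_attractor hr z) (by positivity)
  obtain ⟨N, hN⟩ := ((Filter.eventually_all_finite hI).2 h2).exists
  exact ⟨N, fun r hr => hsub fun z hz => hN z hz r hr⟩

/-! ### Local vectors of the limit measure -/

theorem exists_enumeration {S : Set ℝ} (hS : S.Finite) {x : ℝ} (hx : x ∈ S) :
    ∃ (k : ℕ) (v : Fin (k + 1) → ℝ), Function.Injective v ∧ Set.range v = S ∧ v 0 = x := by
  obtain ⟨n, ⟨e⟩⟩ : ∃ n, Nonempty (S ≃ Fin n) :=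
    (finite_iff_exists_equiv_fin (α := S)).1 hS.to_subtype
  cases n with
  | zero => exact (e ⟨x, hx⟩).elim0
  | succ k =>
    let e' := e.trans (Equiv.swap 0 (e ⟨x, hx⟩))
    refine ⟨k, fun i => e'.symm i, Subtype.val_injective.comp e'.symm.injective, ?_, ?_⟩
    · exact (e'.symm.surjective.range_comp Subtype.val).trans Subtype.range_coe
    · have : e' ⟨x, hx⟩ = 0 := by simp [e']
      change ((e'.symm 0 : S) : ℝ) = x
      rw [← this, Equiv.symm_apply_apply]

section LocalVectors

variable {lam : ℝ} {μ : ℝ → ℝ} {k : ℕ} {v : Fin (k + 1) → ℝ}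

/-- The vector of the values of `μ` at the translates of `x`. -/
def localVector (μ : ℝ → ℝ) (v : Fin (k + 1) → ℝ) (x : ℝ) : Fin (k + 1) → ℝ := fun j => μ (x + v j)

/-- The transfer equation at T_i(x) + v_n involves μ at points x + t. If x + t is in the spectrum
then t coalesces through v_n, so t ∈ Δ and the term is a matrix entry; otherwise μ(x + t) = 0. -/
theorem localVector_T (hβ : β ≠ 0) (hμ0 : ∀ x ∉ spectrum β, μ x = 0)
    (hμT : ∀ x, lam * μ x = transfer β μ x) (hinj : Function.Injective v)
    (hran : Set.range v = translations β) {x : ℝ} (hx : x ∈ spectrum β) {i : ℤ} (hi : IsDigit i) :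
    lam • localVector μ v (T β i x) = Matrix.vecMul (localVector μ v x) (transition β v i) := by
  funext n
  have h1 : Matrix.vecMul (localVector μ v x) (transition β v i) n =
      ∑ m, μ (x + v m) * transition β v i m n := rfl
  have h2 : (lam • localVector μ v (T β i x)) n = lam * μ (T β i x + v n) := rfl
  rw [h1, h2, hμT, transfer]
  simp only [transition_eq_sum, Finset.mul_sum]
  rw [Finset.sum_comm]
  refine Finset.sum_congr rfl fun d _ => ?_
  set t : ℝ := (v n - (d - i)) / β with ht
  have hTt : T β (d - i) t = v n := by
    simp only [T, ht, mul_div_cancel₀ _ hβ]; push_cast; ring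
  have hxt : (T β i x + v n - d) / β = x + t := by
    simp only [T, ht]; field_simp; ring
  have hiff : ∀ m, T β (d - i) (v m) = v n ↔ v m = t := by
    intro m
    rw [← hTt]
    simp [T, hβ]
  rw [hxt]
  simp only [hiff]
  by_cases hmem : t ∈ Set.range v
  · obtain ⟨m₀, hm₀⟩ := hmem
    rw [Finset.sum_eq_single m₀ (fun m _ hm => by
      rw [if_neg (fun h => hm (hinj (h.trans hm₀.symm))), mul_zero]) (by simp)]
    rw [if_pos hm₀, hm₀, mul_comm]
  · rw [hμ0, mul_zero, Finset.sum_eq_zero]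
    · intro m _
      rw [if_neg (fun h => hmem ⟨m, h⟩), mul_zero]
    · intro hxtX
      refine hmem (hran ▸ ?_)
      have hn : v n ∈ translations β := hran ▸ ⟨n, rfl⟩
      obtain ⟨w, hw, hr⟩ := exists_reach_zero hn
      by_cases hd : IsDigit d
      · have h3 : Reach β [i] t (v n) := reach_singleton.2 ⟨d, hd, hTt⟩
        have h4 := mem_translations_iff hxtX hx
        rw [add_sub_cancel_left] at h4
        exact h4.2 ⟨[i] ++ w, by simp [hi, hw], reach_append.2 ⟨_, h3, hr⟩⟩
      · exact absurd (mem_digits.1 ‹d ∈ digits›) hd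

theorem localVector_orbit (hβ : β ≠ 0) (hμ0 : ∀ x ∉ spectrum β, μ x = 0)
    (hμT : ∀ x, lam * μ x = transfer β μ x) (hinj : Function.Injective v)
    (hran : Set.range v = translations β) {x : ℝ} (hx : x ∈ spectrum β) {c : List ℤ}
    (hc : IsWord c) : lam ^ c.length • localVector μ v (orbit β c x) =
      Matrix.vecMul (localVector μ v x) (transitionWord β v c) := by
  induction c generalizing x with
  | nil => simp [transitionWord]
  | cons i c ih =>
    rw [isWord_cons] at hc
    rw [transitionWord_cons, ← Matrix.vecMul_vecMul,
      ← localVector_T hβ hμ0 hμT hinj hran hx hc.1, Matrix.smul_vecMul,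
      ← ih (T_mem_spectrum hc.1 hx) hc.2, smul_smul, List.length_cons, pow_succ, orbit_cons,
      mul_comm]

theorem isAdmissible_localVector (hμpos : ∀ x ∈ spectrum β, 0 < μ x)
    (hμ0 : ∀ x ∉ spectrum β, μ x = 0) (hv0 : v 0 = 0) {x : ℝ} (hx : x ∈ spectrum β) :
    IsAdmissible (localVector μ v x) := by
  refine ⟨fun j => ?_, ?_⟩
  · by_cases h : x + v j ∈ spectrum β
    · exact (hμpos _ h).le
    · exact (hμ0 _ h).ge
  · simpa [localVector, hv0] using hμpos x hx

theorem IsAdmissible.vecMul_word (hinj : Function.Injective v)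
    (hran : Set.range v = translations β) (hv0 : v 0 = 0) {U : Fin (k + 1) → ℝ}
    (hU : IsAdmissible U) {w : List ℤ} (hw : IsWord w) :
    IsAdmissible (Matrix.vecMul U (transitionWord β v w)) := by
  refine hU.vecMul (transitionWord_nonneg v w) ?_
  rw [transitionWord_ne_zero_iff hinj hran hw, hv0]
  exact reach_zero_zero β hw

/-- Contraction along a word with several disjoint copies of a palindrome. -/
theorem exists_decomposition (hinj : Function.Injective v) (hran : Set.range v = translations β)
    (hv0 : v 0 = 0) {w : List ℤ} (hw : IsWord w) (hrev : w.reverse = w) {C : ℝ}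
    (hC : ∀ U V : Fin (k + 1) → ℝ, IsAdmissible U → IsAdmissible V → ∀ c, ProjDistLE U V c →
      ProjDistLE (Matrix.vecMul U (transitionWord β v w))
        (Matrix.vecMul V (transitionWord β v w)) (C * c)) (r : ℕ) {a : List ℤ} (ha : IsWord a)
    (h : HasDisjointCopies w (r + 1) a) : ∃ b q, a = b ++ w ++ q ∧ IsWord b ∧ IsWord q ∧
      ∀ U V : Fin (k + 1) → ℝ, IsAdmissible U → IsAdmissible V → ∀ c, ProjDistLE U V c →
        ProjDistLE (Matrix.vecMul U (transitionWord β v b.reverse))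
          (Matrix.vecMul V (transitionWord β v b.reverse)) (C ^ r * c) := by
  induction r generalizing a with
  | zero =>
    obtain ⟨p, q, rfl, -⟩ := h
    simp only [isWord_append] at ha
    refine ⟨p, q, rfl, ha.1.1, ha.2, fun U V hU hV c hc => ?_⟩
    rw [pow_zero, one_mul]
    exact hc.vecMul (transitionWord_nonneg v _) hU.1 hV.1
  | succ r ih =>
    obtain ⟨p, q, rfl, hq⟩ := h
    simp only [isWord_append] at ha
    obtain ⟨b, q', rfl, hb, hq', hcon⟩ := ih ha.2 hq
    -- The last copy of `w` is kept aside because cylinder maps act from the last letter backwards;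
    -- the `r` copies before it each contribute a factor `C`.
    refine ⟨p ++ w ++ b, q', by simp, by simp [ha.1.1, hw, hb], hq', fun U V hU hV c hc => ?_⟩
    have hb' : IsWord b.reverse := isWord_reverse.2 hb
    have h1 := hcon U V hU hV c hc
    have hU1 := hU.vecMul_word hinj hran hv0 hb'
    have hV1 := hV.vecMul_word hinj hran hv0 hb'
    have h2 := hC _ _ hU1 hV1 _ h1
    have h3 := h2.vecMul (transitionWord_nonneg (β := β) v p.reverse)
      (hU1.vecMul_word hinj hran hv0 hw).1
      (hV1.vecMul_word hinj hran hv0 hw).1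
    simp only [Matrix.vecMul_vecMul, ← transitionWord_append] at h3
    have e : (p ++ w ++ b).reverse = b.reverse ++ w ++ p.reverse := by simp [hrev]
    rw [e, pow_succ']
    rwa [← mul_assoc] at h3

end LocalVectors

/-! ### Points of the spectrum in cylinders -/

/-- The palindrome reconciles cylinders, which compose from the right, with matrices and orbits,
which read from the left. The final block of zeros pushes the attractor into its interior. -/
theorem exists_synchronizing (hβ : IsHyperbolic β) (hcond : CutProjectCondition β) :
    ∃ s u t : List ℤ, IsWord s ∧ IsWord u ∧ IsWord t ∧ s = u ++ t ∧ s.reverse = s ∧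
      RowGood β u ∧ ColGood β t ∧
      ∀ r ∈ attractor β, orbit (conjC β) s r ∈ interior (attractor β) := by
  obtain ⟨N, hN⟩ := exists_zero_cylinder_subset (zero_mem_interior_attractor hβ hcond)
  obtain ⟨w₁, hw₁, hrow⟩ := exists_rowGood hβ
  obtain ⟨w₂, hw₂, hcol⟩ := exists_colGood hβ
  set z := List.replicate N (0 : ℤ) with hz
  have hzw : IsWord z := isWord_replicate N
  have hs' : IsWord (z ++ w₁ ++ w₂ ++ w₂.reverse ++ w₁.reverse) := by simp [hzw, hw₁, hw₂]
  refine ⟨z ++ w₁ ++ w₂ ++ w₂.reverse ++ w₁.reverse ++ z, z ++ w₁,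
    w₂ ++ (w₂.reverse ++ w₁.reverse ++ z), by simp [hzw, hw₁, hw₂], by simp [hzw, hw₁],
    by simp [hzw, hw₁, hw₂], by simp, by simp [hz], hrow.append_left hw₁ hzw,
    hcol.append_right hw₂ (by simp [hzw, hw₁, hw₂]), fun r hr => ?_⟩
  rw [orbit_append, orbit_eq _ z, hz, value_replicate_zero, add_zero, List.length_replicate]
  exact hN _ (orbit_mem_attractor hs' hr)

/-- Compare the preimage y ∈ ℤ[β] of x along `s ++ b` with a genuine ancestor ξ ∈ X(β) of x of the
same age. Their difference coalesces, so by `RowGood` it does so already along `s`; hence the image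
of y under `s` is also an image of ξ and lies in X(β). -/
theorem exists_preimage_in_spectrum (hβ : IsHyperbolic β) {s b : List ℤ} (hs : IsWord s)
    (hb : IsWord b) (hrow : RowGood β s) {x : ℝ} (hx : x ∈ spectrum β) {r : ContractingSpace β}
    (hr : r ∈ attractor β) (hl : Lifts β x (orbit (conjC β) (s ++ b) r)) :
    ∃ y ∈ spectrum β, x = orbit β b y := by
  obtain ⟨y, hy, hxy⟩ := hl.exists_preimage hβ
  obtain ⟨c, hc, hlen, ξ, hξ, hxξ⟩ := exists_orbit_of_mem_spectrum hx (s ++ b).length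
  have h1 : Reach β (s ++ b) (ξ - y) 0 :=
    (reach_iff y).2 ⟨c, hc, hlen, by rw [add_sub_cancel, add_zero, ← hxξ, hxy]⟩
  have hdiff : ξ - y ∈ differences β :=
    ⟨ξ, hξ, y, r, hy, hr, rfl, s ++ b, isWord_append.2 ⟨hs, hb⟩, h1⟩
  obtain ⟨t, h2, h3⟩ := reach_append.1 h1
  obtain ⟨d, hd, -, h4⟩ := (reach_iff y).1 (hrow _ hdiff t h2 ⟨b, hb, h3⟩)
  rw [add_sub_cancel, add_zero] at h4
  refine ⟨orbit β s y, h4 ▸ orbit_mem_spectrum hd hξ, ?_⟩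
  rw [hxy, orbit_append]

theorem image_orbit_mem_nhds (hβ : IsHyperbolic β) (c : List ℤ) {O : Set (ContractingSpace β)}
    (hO : IsOpen O) {r : ContractingSpace β} (hr : r ∈ O) :
    orbit (conjC β) c '' O ∈ 𝓝 (orbit (conjC β) c r) := by
  obtain ⟨Q, hQ⟩ := hβ.exists_inverse
  have hQ' := conjC_mul_inverse hQ
  set q := Polynomial.aeval (conjC β) Q
  let g : ContractingSpace β → ContractingSpace β := fun t => q ^ c.length * (t - value (conjC β) c)
  have hpow : conjC β ^ c.length * q ^ c.length = 1 := by rw [← mul_pow, hQ', one_pow]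
  have hg1 : ∀ t, orbit (conjC β) c (g t) = t := by
    intro t
    rw [orbit_eq]
    simp only [g]
    rw [← mul_assoc, hpow]; ring
  have hg2 : g (orbit (conjC β) c r) = r := by
    rw [orbit_eq]
    simp only [g]
    rw [add_sub_cancel_right, ← mul_assoc, mul_comm (q ^ _), hpow, one_mul]
  have hgc : Continuous g := by fun_prop
  refine Filter.mem_of_superset (hgc.continuousAt.preimage_mem_nhds (hO.mem_nhds ?_)) ?_
  · rw [hg2]; exact hr
  · exact fun t ht => ⟨g t, ht, hg1 t⟩

/-! ### Extension to the attractor -/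

open Classical in
/-- The extension of a function of words `g`, which depends only on the point of the contracting
space, to the whole space. -/
def extend (β : ℝ) (g : List ℤ → ℝ) (p : ContractingSpace β) : ℝ :=
  if h : ∃ c, IsWord c ∧ value (conjC β) c = p then g h.choose
  else limsup (fun c : {c : List ℤ // IsWord c} => g c)
    (comap (fun c : {c : List ℤ // IsWord c} => value (conjC β) c.1) (𝓝 p))

theorem extend_value {g : List ℤ → ℝ}
    (hg : ∀ c d, IsWord c → IsWord d → value (conjC β) c = value (conjC β) d → g c = g d)
    {c : List ℤ} (hc : IsWord c) : extend β g (value (conjC β) c) = g c := by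
  have h : ∃ d, IsWord d ∧ value (conjC β) d = value (conjC β) c := ⟨c, hc, rfl⟩
  rw [extend, dif_pos h]
  exact hg _ _ h.choose_spec.1 hc h.choose_spec.2

/-- The limsup runs over a non-trivial filter, by density of the word values in the attractor, so
bounds on a neighbourhood pass to it. -/
theorem extend_mem_Icc {g : List ℤ → ℝ} {O : Set (ContractingSpace β)} {p : ContractingSpace β}
    (hp : p ∈ attractor β) (hO : O ∈ 𝓝 p) {m M : ℝ}
    (h : ∀ c, IsWord c → value (conjC β) c ∈ O → g c ∈ Set.Icc m M) :
    extend β g p ∈ Set.Icc m M := by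
  unfold extend
  split_ifs with hc
  · exact h _ hc.choose_spec.1 (hc.choose_spec.2.symm ▸ mem_of_mem_nhds hO)
  · set l := comap (fun c : {c : List ℤ // IsWord c} => value (conjC β) c.1) (𝓝 p)
    have : l.NeBot := by
      refine comap_neBot fun t ht => ?_
      obtain ⟨c, hc, hct⟩ := exists_value_mem_of_mem_nhds hp ht
      exact ⟨⟨c, hc⟩, hct⟩
    have hev : ∀ᶠ c : {c : List ℤ // IsWord c} in l, g c ∈ Set.Icc m M := by
      filter_upwards [preimage_mem_comap hO] with c hc using h c.1 c.2 hc
    have hle : ∀ᶠ c : {c : List ℤ // IsWord c} in l, g c ≤ M := hev.mono fun _ h => h.2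
    have hge : ∀ᶠ c : {c : List ℤ // IsWord c} in l, m ≤ g c := hev.mono fun _ h => h.1
    exact ⟨le_limsup_of_frequently_le hge.frequently (isBoundedUnder_of_eventually_le hle),
      limsup_le_of_le (isBoundedUnder_of_eventually_ge hge).isCoboundedUnder_le hle⟩

theorem abs_extend_sub_le {g : List ℤ → ℝ} {O : Set (ContractingSpace β)}
    {p q : ContractingSpace β} (hp : p ∈ attractor β) (hq : q ∈ attractor β) (hOp : O ∈ 𝓝 p)
    (hOq : O ∈ 𝓝 q) {ε : ℝ} (h : ∀ c d, IsWord c → IsWord d → value (conjC β) c ∈ O →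
      value (conjC β) d ∈ O → |g c - g d| ≤ ε) :
    |extend β g p - extend β g q| ≤ ε := by
  have h1 : ∀ d, IsWord d → value (conjC β) d ∈ O →
      g d ∈ Set.Icc (extend β g p - ε) (extend β g p + ε) := by
    intro d hd hdO
    have := extend_mem_Icc (g := g) (m := g d - ε) (M := g d + ε) hp hOp fun c hc hcO => by
      have := abs_sub_le_iff.1 (h c d hc hd hcO hdO)
      exact ⟨by linarith, by linarith⟩
    exact ⟨by linarith [this.2], by linarith [this.1]⟩
  have h2 := extend_mem_Icc hq hOq h1
  exact abs_sub_le_iff.2 ⟨by linarith [h2.1], by linarith [h2.2]⟩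

theorem ProjDistLE.abs_log_ratio_sub_le {k : ℕ} {U V : Fin (k + 1) → ℝ} {ε : ℝ}
    (hU : 0 < U 0) (h : ProjDistLE U V ε) (j : Fin (k + 1)) :
    |Real.log (U j / U 0) - Real.log (V j / V 0)| ≤ ε := by
  have hV : V 0 ≠ 0 := mt (h.1 0).2 hU.ne'
  by_cases hj : U j = 0
  -- Both ratios vanish here, and `Real.log 0 = 0`.
  · rw [hj, (h.1 j).1 hj]
    simpa using (abs_nonneg _).trans (h.2 0 0 hU.ne' hU.ne')
  · have hj' := mt (h.1 j).2 hj
    have := h.2 j 0 hj hU.ne'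
    rw [Real.log_div hj hj', Real.log_div hU.ne' hV] at this
    rw [Real.log_div hj hU.ne', Real.log_div hj' hV]
    convert this using 2
    ring

end Spectra

end

/-! ### Assembly of the theorem -/

open Spectra in
theorem theorem3 (β : ℝ) (hβ : Spectra.IsHyperbolic β) (hcond : Spectra.CutProjectCondition β) :
    ∃ (lam : ℝ) (μ : ℝ → ℝ),
      -- the limit measure on the spectrum
      1 < lam ∧
      (∀ x : ℝ, Tendsto (fun n : ℕ => (Spectra.count β n x : ℝ) / lam ^ n) atTop (𝓝 (μ x))) ∧
      (∀ x ∈ Spectra.spectrum β, 0 < μ x) ∧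
      -- the finite set of translations, enumerated with `v 0 = 0`
      ∃ (k : ℕ) (v : Fin (k + 1) → ℝ),
        Function.Injective v ∧ Set.range v = Spectra.translations β ∧ v 0 = 0 ∧
        -- every point is reached from `0` by finitely many translations, inside the spectrum
        (∀ x ∈ Spectra.spectrum β,
          Relation.ReflTransGen
            (fun y z => y ∈ Spectra.spectrum β ∧ z ∈ Spectra.spectrum β ∧
              z - y ∈ Spectra.translations β) 0 x) ∧
        ∃ (f : Fin (k + 1) → Spectra.attractor β → ℝ) (w : List ℤ) (C₁ C₂ : ℝ),
          -- the log-ratio is a function of the contracting-space point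
          (∀ c : List ℤ, Spectra.IsWord c →
            ∃ hc : Spectra.value (Spectra.conjC β) c ∈ Spectra.attractor β,
              ∀ j, Spectra.value β c + v j ∈ Spectra.spectrum β →
                Real.log (μ (Spectra.value β c + v j) / μ (Spectra.value β c)) =
                  f j ⟨Spectra.value (Spectra.conjC β) c, hc⟩) ∧
          -- the mixing word
          Spectra.IsWord w ∧ Spectra.IsMixing β v w ∧
          0 < C₁ ∧ 0 < C₂ ∧ C₂ < 1 ∧
          -- contraction of the projective distance
          (∀ U V : Fin (k + 1) → ℝ, Spectra.IsAdmissible U → Spectra.IsAdmissible V →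
            Spectra.ProjDistLE (Matrix.vecMul U (Spectra.transitionWord β v w))
              (Matrix.vecMul V (Spectra.transitionWord β v w)) C₁ ∧
            (∀ c : ℝ, Spectra.ProjDistLE U V c →
              Spectra.ProjDistLE (Matrix.vecMul U (Spectra.transitionWord β v w))
                (Matrix.vecMul V (Spectra.transitionWord β v w)) (C₂ * c)) ∧
            (∀ c : ℝ, Spectra.ProjDistLE U V c → ∀ i : ℤ, Spectra.IsDigit i →
              Spectra.ProjDistLE (Matrix.vecMul U (Spectra.transition β v i))
                (Matrix.vecMul V (Spectra.transition β v i)) c)) ∧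
          -- on cylinders whose code contains `r` disjoint copies of `w`
          (∀ (a : List ℤ) (r : ℕ), Spectra.IsWord a → 1 ≤ r → Spectra.HasDisjointCopies w r a →
            -- the local measures are projectively close
            (∀ c d : List ℤ, Spectra.IsWord c → Spectra.IsWord d →
              Spectra.value (Spectra.conjC β) c ∈ Spectra.cylinder β a →
              Spectra.value (Spectra.conjC β) d ∈ Spectra.cylinder β a →
              Spectra.ProjDistLE (fun j => μ (Spectra.value β c + v j))
                (fun j => μ (Spectra.value β d + v j)) (C₁ * C₂ ^ (r - 1))) ∧
            -- and the functions `f j` vary little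
            (∀ (j : Fin (k + 1)) (p q : Spectra.attractor β),
              (p : Spectra.ContractingSpace β) ∈ Spectra.cylinder β a →
              (q : Spectra.ContractingSpace β) ∈ Spectra.cylinder β a →
              |f j p - f j q| ≤ C₁ * C₂ ^ (r - 1))) := by
  obtain ⟨lam, μ, hlam, hlim, hpos, hzero, htransfer⟩ := exists_limit hβ
  obtain ⟨k, v, hinj, hran, hv0⟩ := exists_enumeration (finite_translations hβ)
    zero_mem_translations
  refine ⟨lam, μ, hlam, hlim, hpos, k, v, hinj, hran, hv0, fun x hx => spectrum_connected hβ hx, ?_⟩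
  obtain ⟨s, u, t, hs, hu, ht, hsut, hrev, hrow, hcol, hint⟩ := exists_synchronizing hβ hcond
  have hrowS : RowGood β s := hsut ▸ hrow.append_right ht
  obtain ⟨I, J, hI, -, hIJ⟩ := isMixing_append hinj hran hv0 hu ht hrow hcol
  rw [← hsut] at hIJ
  obtain ⟨C₁, C₂, hC₁, hC₂, hC₂', hcontr⟩ :=
    exists_contraction (transitionWord_nonneg v s) hI hIJ
  -- The mixing word has three blocks with separate tasks, in order of application: enter the
  -- interior of the attractor, move the preimage into the spectrum, and contract to distance at
  -- most `C₁`.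
  have hw : IsWord (s ++ s ++ s) := by simp [hs]
  have hwrev : (s ++ s ++ s).reverse = s ++ s ++ s := by simp [hrev]
  have hadm : ∀ U : Fin (k + 1) → ℝ, IsAdmissible U → ∀ c, IsWord c →
      IsAdmissible (Matrix.vecMul U (transitionWord β v c)) :=
    fun U hU c hc => hU.vecMul_word hinj hran hv0 hc
  have hweak : ∀ U V : Fin (k + 1) → ℝ, IsAdmissible U → IsAdmissible V → ∀ c,
      ProjDistLE (Matrix.vecMul U (transitionWord β v s))
        (Matrix.vecMul V (transitionWord β v s)) c →
      ProjDistLE (Matrix.vecMul U (transitionWord β v (s ++ s ++ s)))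
        (Matrix.vecMul V (transitionWord β v (s ++ s ++ s))) c := by
    intro U V hU hV c h
    have h1 := h.vecMul (transitionWord_nonneg (β := β) v (s ++ s)) (hadm U hU s hs).1
      (hadm V hV s hs).1
    simpa only [Matrix.vecMul_vecMul, ← transitionWord_append, ← List.append_assoc] using h1
  have hcontr' : ∀ U V : Fin (k + 1) → ℝ, IsAdmissible U → IsAdmissible V → ∀ c,
      ProjDistLE U V c → ProjDistLE (Matrix.vecMul U (transitionWord β v (s ++ s ++ s)))
        (Matrix.vecMul V (transitionWord β v (s ++ s ++ s))) (C₂ * c) :=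
    fun U V hU hV c h => hweak U V hU hV _ ((hcontr U V hU hV).2 c h)
  -- An open set around the cylinder is needed: a point of the cylinder that is not a word value is
  -- approximated by word values which may lie outside the cylinder. One copy of the word is spent
  -- on `O` and `C₁`, leaving the exponent r - 1.
  have hlocal : ∀ (a : List ℤ) (r : ℕ), IsWord a → 1 ≤ r →
      HasDisjointCopies (s ++ s ++ s) r a → ∃ O : Set (ContractingSpace β),
        (∀ p ∈ cylinder β a, O ∈ 𝓝 p) ∧ ∀ c d : List ℤ, IsWord c → IsWord d →
          value (conjC β) c ∈ O → value (conjC β) d ∈ O →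
          ProjDistLE (localVector μ v (value β c)) (localVector μ v (value β d))
            (C₁ * C₂ ^ (r - 1)) := by
    intro a r ha hr hcop
    obtain ⟨r, rfl⟩ := Nat.exists_eq_add_of_le' hr
    obtain ⟨b, q, rfl, hb, hq, hbc⟩ :=
      exists_decomposition hinj hran hv0 hw hwrev hcontr' r ha hcop
    have hb' : IsWord b.reverse := isWord_reverse.2 hb
    refine ⟨orbit (conjC β) (s ++ (s ++ b.reverse)) '' interior (attractor β), ?_, ?_⟩
    · intro p hp
      rw [cylinder_eq] at hp
      obtain ⟨e, he, rfl⟩ := hp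
      have h1 : (b ++ (s ++ s ++ s) ++ q).reverse =
          (q.reverse ++ s) ++ (s ++ (s ++ b.reverse)) := by simp [hrev]
      rw [h1, orbit_append]
      refine image_orbit_mem_nhds hβ _ isOpen_interior ?_
      rw [orbit_append]
      exact hint _ (orbit_mem_attractor (isWord_reverse.2 hq) he)
    · have hpre : ∀ c, IsWord c →
          value (conjC β) c ∈ orbit (conjC β) (s ++ (s ++ b.reverse)) '' interior (attractor β) →
          ∃ y ∈ spectrum β, lam ^ (s ++ b.reverse).length • localVector μ v (value β c) =
            Matrix.vecMul (Matrix.vecMul (localVector μ v y) (transitionWord β v s))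
              (transitionWord β v b.reverse) := by
        rintro c hc ⟨e, he, hce⟩
        obtain ⟨y, hy, hcy⟩ := exists_preimage_in_spectrum hβ hs
          (isWord_append.2 ⟨hs, hb'⟩) hrowS (value_mem_spectrum β hc) (interior_subset he)
          (hce ▸ lifts_value c)
        refine ⟨y, hy, ?_⟩
        rw [hcy, localVector_orbit hβ.pos.ne' hzero htransfer hinj hran hy
          (isWord_append.2 ⟨hs, hb'⟩), Matrix.vecMul_vecMul, transitionWord_append]
      intro c d hc hd hcO hdO
      obtain ⟨y, hy, hcy⟩ := hpre c hc hcO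
      obtain ⟨z, hz, hdz⟩ := hpre d hd hdO
      have ay := isAdmissible_localVector (v := v) hpos hzero hv0 hy
      have az := isAdmissible_localVector (v := v) hpos hzero hv0 hz
      have h1 := hbc _ _ (hadm _ ay s hs) (hadm _ az s hs) _ (hcontr _ _ ay az).1
      rw [← hcy, ← hdz] at h1
      have hne : lam ^ (s ++ b.reverse).length ≠ 0 := pow_ne_zero _ (by linarith)
      have h2 := h1.smul (inv_ne_zero hne) (inv_ne_zero hne)
      rw [smul_smul, smul_smul, inv_mul_cancel₀ hne, one_smul, one_smul] at h2
      rwa [Nat.add_sub_cancel, mul_comm]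
  -- Where x + v_j is outside the spectrum, μ(x + v_j) = 0 and this takes the default value
  -- `Real.log 0 = 0`. That is harmless, since projectively close vectors share their zero entries.
  let g : Fin (k + 1) → List ℤ → ℝ := fun j c =>
    Real.log (localVector μ v (value β c) j / localVector μ v (value β c) 0)
  have hg0 : ∀ c, localVector μ v (value β c) 0 = μ (value β c) := fun c => by
    simp [localVector, hv0]
  have hg : ∀ j c d, IsWord c → IsWord d → value (conjC β) c = value (conjC β) d →
      g j c = g j d := by
    intro j c d _ _ hcd
    have h1 : Lifts β (value β d) (value (conjC β) c) := hcd ▸ lifts_value d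
    simp only [g, (lifts_value c).injective hβ h1]
  refine ⟨fun j p => extend β (g j) p, s ++ s ++ s, C₁, C₂, ?_, hw, ?_, hC₁, hC₂, hC₂', ?_, ?_⟩
  · intro c hc
    refine ⟨value_mem_attractor hc, fun j _ => ?_⟩
    refine Eq.trans ?_ (extend_value (hg j) hc).symm
    simp only [g, hg0]
    rfl
  · have h1 : s ++ s ++ s = u ++ (t ++ (s ++ s)) := by
      nth_rewrite 1 [hsut]; simp
    rw [h1]
    exact isMixing_append hinj hran hv0 hu (by simp [hs, ht]) hrow
      (hcol.append_right ht (by simp [hs]))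
  · exact fun U V hU hV => ⟨hweak U V hU hV _ (hcontr U V hU hV).1, hcontr' U V hU hV,
      fun c h i _ => h.vecMul (transition_nonneg v i) hU.1 hV.1⟩
  · intro a r ha hr hcop
    obtain ⟨O, hO, hloc⟩ := hlocal a r ha hr hcop
    refine ⟨fun c d hc hd hca hda => hloc c d hc hd (mem_of_mem_nhds (hO _ hca))
      (mem_of_mem_nhds (hO _ hda)), fun j p q hp hq => ?_⟩
    refine abs_extend_sub_le p.2 q.2 (hO _ hp) (hO _ hq) fun c d hc hd hcO hdO => ?_
    exact (hloc c d hc hd hcO hdO).abs_log_ratio_sub_le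
      (isAdmissible_localVector hpos hzero hv0 (value_mem_spectrum β hc)).2 j
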